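/- Let $R\in M_d(\mathbb Z)$ be expansive (every complex eigenvalue has modulus $>1$), and let $B\subset\mathbb Z^d$ be a nonempty finite set with $N=\#B$. Put $B_n=\{\sum_{j=0}^{n-1}R^jb_j: b_j\in B\}$. Let $\mu=\mu(R,B)$ be the unique Borel probability measure on $\mathbb R^d$ with $\mu(E)=\sum_{b\in B}\frac1N\,\mu(\tau_b^{-1}(E))$ for all Borel sets $E$, where $\tau_b(x)=R^{-1}(x+b)$, and let $\widehat\mu(\xi)=\int e^{-2\pi i\langle\xi,x\rangle}\,d\mu(x)$. For $\epsilon\ge 0$, $n\ge1$ and a finite set $J\subset\mathbb Z^d$, let $P(\epsilon,n,J)$ denote the property that for all $(w_b)_{b\in B_n}\in\mathbb C^{B_n}$ $$(1-\epsilon)\sum_{b\in B_n}|w_b|^2\le\sum_{\lambda\in J}\Big|\frac1{\sqrt{N^n}}\sum_{b\in B_n}w_be^{-2\pi i\langle R^{-n}b,\lambda\rangle}\Big|^2\le(1+\epsilon)\sum_{b\in B_n}|w_b|^2 .$$ Suppose that - $B$ is a simple digit set for $R$, i.e. distinct elements of $B$ are incongruent modulo $R(\mathbb Z^d)$; - $(R,B)$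 satisfies the almost-Parseval-frame condition: for every $\epsilon>0$ there are $n\ge1$ and a finite $J\subset\mathbb Z^d$ with $P(\epsilon,n,J)$; - $\mathcal Z:=\{\xi\in\mathbb R^d:\widehat\mu(\xi+k)=0\text{ for all }k\in\mathbb Z^d\}=\emptyset$. Then the following hold. (i) There is $\Lambda\subset\mathbb Z^d$ such that $E(\Lambda)=\{e^{2\pi i\langle\lambda,x\rangle}:\lambda\in\Lambda\}$ is a Fourier frame for $L^2(\mu)$: there are $0<A\le C<\infty$ with $$A\|f\|^2\le\sum_{\lambda\in\Lambda}\Big|\int f(x)e^{-2\pi i\langle\lambda,x\rangle}\,d\mu(x)\Big|^2\le C\|f\|^2\qquad\text{for all } f\in L^2(\mu).$$ For sequences of integers $n_k\ge1$ and of finite sets $J_{n_k}\subset\mathbb Z^d$ with $0\in J_{n_k}$ $(k\ge1)$, put $m_k=n_1+\dots+n_k$, $\Lambda_k=J_{n_1}+(R^T)^{m_1}J_{n_2}+\dots+(R^T)^{m_{k-1}}J_{n_k}$, $\Lambda=\bigcup_{k\ge1}\Lambda_k\subset\mathbb Z^d$ and $\delta(\Lambda)=\inf_{k\ge1}\inf_{\lambda\in\Lambda_k}|\widehat\mu((R^T)^{-m_k}\lambda)|^2$.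 (ii) For every sequence $\epsilon_k\in(0,1)$ with $\sum_k\epsilon_k<\infty$ there are such sequences with $P(\epsilon_k,n_k,J_{n_k})$ for all $k$ and $\delta(\Lambda)>0$. (iii) Whenever $\epsilon_k\in[0,1)$, $\sum_k\epsilon_k<\infty$, $P(\epsilon_k,n_k,J_{n_k})$ holds for all $k$ and $\delta(\Lambda)>0$, then $E(\Lambda)$ is a Fourier frame for $L^2(\mu)$ with lower and upper frame bounds $\delta(\Lambda)\prod_{j=1}^\infty(1-\epsilon_j)>0$ and $\prod_{j=1}^\infty(1+\epsilon_j)<\infty$ (not claimed to be optimal). -/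

import Mathlib

open MeasureTheory Filter Topology

namespace SelfAffine

noncomputable section

/-- An integer vector, seen as a point of `ℝ^d`. -/
def toReal {d : ℕ} (v : Fin d → ℤ) : Fin d → ℝ := fun i => (v i : ℝ)

/-- The real matrix `R⁻¹` of an integer matrix `R`. -/
def invMat {d : ℕ} (R : Matrix (Fin d) (Fin d) ℤ) : Matrix (Fin d) (Fin d) ℝ :=
  (R.map (Int.cast : ℤ → ℝ))⁻¹

/-- `R` is expansive: all its complex eigenvalues have modulus strictly greater than `1`. -/
def IsExpansive {d : ℕ} (R : Matrix (Fin d) (Fin d) ℤ) : Prop :=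
  ∀ z ∈ spectrum ℂ (R.map (Int.cast : ℤ → ℂ)), 1 < ‖z‖

/-- `B` is a simple digit set for `R`: distinct elements of `B` are incongruent modulo
`R(ℤ^d)`. -/
def IsSimpleDigitSet {d : ℕ} (R : Matrix (Fin d) (Fin d) ℤ) (B : Finset (Fin d → ℤ)) : Prop :=
  ∀ b ∈ B, ∀ b' ∈ B, b ≠ b' → ¬ ∃ k : Fin d → ℤ, b - b' = R.mulVec k

/-- The contraction `τ_b(x) = R⁻¹(x + b)` on `ℝ^d`. -/
def ifsMap {d : ℕ} (R : Matrix (Fin d) (Fin d) ℤ) (b : Fin d → ℤ) (x : Fin d → ℝ) : Fin d → ℝ :=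
  (invMat R).mulVec (x + toReal b)

/-- `μ` is a Borel probability measure with
`μ(E) = ∑_{b ∈ B} (1/N) μ(τ_b⁻¹(E))` for all Borel sets `E`, where `N = #B`. -/
def IsSelfAffineMeasure {d : ℕ} (R : Matrix (Fin d) (Fin d) ℤ) (B : Finset (Fin d → ℤ))
    (μ : Measure (Fin d → ℝ)) : Prop :=
  IsProbabilityMeasure μ ∧ ∀ E : Set (Fin d → ℝ), MeasurableSet E →
    μ E = ∑ b ∈ B, (B.card : ENNReal)⁻¹ * μ (ifsMap R b ⁻¹' E)

open Classical in
/-- The self-affine measure `μ(R, B)` (with equal weights): the unique Borel probability measure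
with the invariance property `IsSelfAffineMeasure`. Existence and uniqueness for expansive `R`
and nonempty `B` are `existsUnique_isSelfAffineMeasure` below. -/
def selfAffineMeasure {d : ℕ} (R : Matrix (Fin d) (Fin d) ℤ) (B : Finset (Fin d → ℤ)) :
    Measure (Fin d → ℝ) :=
  if h : ∃ μ, IsSelfAffineMeasure R B μ then h.choose else 0

/-- The Fourier transform `μ̂(ξ) = ∫ e^{-2π i ⟨ξ, x⟩} dμ(x)`. -/
def fourierMeasure {d : ℕ} (μ : Measure (Fin d → ℝ)) (ξ : Fin d → ℝ) : ℂ :=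
  ∫ x, Complex.exp (-2 * Real.pi * Complex.I * ((ξ ⬝ᵥ x : ℝ) : ℂ)) ∂μ

/-- The periodic zero set `𝒵 = {ξ : μ̂(ξ + k) = 0 for all k ∈ ℤ^d}`. -/
def periodicZeroSet {d : ℕ} (μ : Measure (Fin d → ℝ)) : Set (Fin d → ℝ) :=
  {ξ | ∀ k : Fin d → ℤ, fourierMeasure μ (ξ + toReal k) = 0}

/-- `E(Λ)`, with `Λ ⊆ ℤ^d`, satisfies the frame inequalities
`A‖f‖² ≤ ∑_{λ ∈ Λ} |∫ f(x) e^{-2π i ⟨λ, x⟩} dμ(x)|² ≤ C‖f‖²` for all `f ∈ L²(μ)`; convergence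
of the series is part of the claim. -/
def HasFrameBounds {d : ℕ} (μ : Measure (Fin d → ℝ)) (Λ : Set (Fin d → ℤ)) (A C : ℝ) : Prop :=
  ∀ f : Lp ℂ 2 μ, ∃ S : ℝ,
    HasSum (fun l : Λ => ‖∫ x, f x *
      Complex.exp (-2 * Real.pi * Complex.I * ((toReal l.1 ⬝ᵥ x : ℝ) : ℂ)) ∂μ‖ ^ 2) S ∧
    A * ‖f‖ ^ 2 ≤ S ∧ S ≤ C * ‖f‖ ^ 2

/-- `E(Λ)` is a Fourier frame for `L²(μ)`. -/
def IsFourierFrame {d : ℕ} (μ : Measure (Fin d → ℝ)) (Λ : Set (Fin d → ℤ)) : Prop :=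
  ∃ A C : ℝ, 0 < A ∧ A ≤ C ∧ HasFrameBounds μ Λ A C

/-- `B_n = B + RB + ⋯ + R^{n-1}B`. -/
def digitSums {d : ℕ} (R : Matrix (Fin d) (Fin d) ℤ) (B : Finset (Fin d → ℤ)) (n : ℕ) :
    Finset (Fin d → ℤ) :=
  (Fintype.piFinset fun _ : Fin n => B).image fun b => ∑ j : Fin n, (R ^ (j : ℕ)).mulVec (b j)

/-- The matrix `F_n = N^{-n/2} [e^{-2π i ⟨R^{-n} b, l⟩}]_{l ∈ J, b ∈ B_n}` satisfies
`(1-ε)‖w‖² ≤ ‖F_n w‖² ≤ (1+ε)‖w‖²` for all complex vectors `w` indexed by `B_n` (only the values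
of `w` on `B_n` enter). -/
def IsAlmostParseval {d : ℕ} (R : Matrix (Fin d) (Fin d) ℤ) (B : Finset (Fin d → ℤ))
    (ε : ℝ) (n : ℕ) (J : Finset (Fin d → ℤ)) : Prop :=
  ∀ w : (Fin d → ℤ) → ℂ,
    (1 - ε) * ∑ b ∈ digitSums R B n, ‖w b‖ ^ 2 ≤
      ∑ l ∈ J, ‖((Real.sqrt ((B.card : ℝ) ^ n) : ℝ) : ℂ)⁻¹ * ∑ b ∈ digitSums R B n, w b *
        Complex.exp (-2 * Real.pi * Complex.I *
          ((((invMat R) ^ n).mulVec (toReal b) ⬝ᵥ toReal l : ℝ) : ℂ))‖ ^ 2 ∧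
    ∑ l ∈ J, ‖((Real.sqrt ((B.card : ℝ) ^ n) : ℝ) : ℂ)⁻¹ * ∑ b ∈ digitSums R B n, w b *
        Complex.exp (-2 * Real.pi * Complex.I *
          ((((invMat R) ^ n).mulVec (toReal b) ⬝ᵥ toReal l : ℝ) : ℂ))‖ ^ 2 ≤
      (1 + ε) * ∑ b ∈ digitSums R B n, ‖w b‖ ^ 2

/-- The almost-Parseval-frame condition for `(R, B)`. The level `n` is a positive integer:
at `n = 0` the inequalities hold trivially with `J = {0}`. -/
def AlmostParsevalFrameCondition {d : ℕ} (R : Matrix (Fin d) (Fin d) ℤ)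
    (B : Finset (Fin d → ℤ)) : Prop :=
  ∀ ε : ℝ, 0 < ε → ∃ n : ℕ, 0 < n ∧ ∃ J : Finset (Fin d → ℤ), IsAlmostParseval R B ε n J

/-- `m_k = n_1 + ⋯ + n_k`; the sequence `n_1, n_2, …` is `n 0, n 1, …`. -/
def level (n : ℕ → ℕ) (k : ℕ) : ℕ := ∑ i ∈ Finset.range k, n i

open scoped Pointwise in
/-- `Λ_k = J_{n_1} + (Rᵀ)^{m_1} J_{n_2} + ⋯ + (Rᵀ)^{m_{k-1}} J_{n_k}`, with `Λ_0 = {0}`; the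
sequence `J_{n_1}, J_{n_2}, …` is `J 0, J 1, …`. -/
def towerLevel {d : ℕ} (R : Matrix (Fin d) (Fin d) ℤ) (n : ℕ → ℕ)
    (J : ℕ → Finset (Fin d → ℤ)) : ℕ → Finset (Fin d → ℤ)
  | 0 => {0}
  | k + 1 => towerLevel R n J k + (J k).image (R.transpose ^ level n k).mulVec

/-- `Λ = ⋃_{k ≥ 1} Λ_k`. -/
def tower {d : ℕ} (R : Matrix (Fin d) (Fin d) ℤ) (n : ℕ → ℕ)
    (J : ℕ → Finset (Fin d → ℤ)) : Set (Fin d → ℤ) :=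
  {l | ∃ k, 1 ≤ k ∧ l ∈ towerLevel R n J k}

/-- `δ(Λ) = inf_{k ≥ 1} inf_{l ∈ Λ_k} |μ̂((Rᵀ)^{-m_k} l)|²`. -/
def towerDelta {d : ℕ} (R : Matrix (Fin d) (Fin d) ℤ) (μ : Measure (Fin d → ℝ)) (n : ℕ → ℕ)
    (J : ℕ → Finset (Fin d → ℤ)) : ℝ :=
  sInf {r | ∃ k, 1 ≤ k ∧ ∃ l ∈ towerLevel R n J k,
    r = ‖fourierMeasure μ (((invMat R).transpose ^ level n k).mulVec (toReal l))‖ ^ 2}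

/-- The data of a tower for the tolerances `ε_1, ε_2, …`: positive integers `n_k` and finite sets
`J_{n_k} ⊆ ℤ^d` containing `0` that satisfy the almost-Parseval inequalities with `ε_k`. -/
def IsTower {d : ℕ} (R : Matrix (Fin d) (Fin d) ℤ) (B : Finset (Fin d → ℤ)) (ε : ℕ → ℝ)
    (n : ℕ → ℕ) (J : ℕ → Finset (Fin d → ℤ)) : Prop :=
  ∀ k, 0 < n k ∧ 0 ∈ J k ∧ IsAlmostParseval R B (ε k) (n k) (J k)

/-! ### Existence and uniqueness of the self-affine measure -/

section Matrices

attribute [local instance] Matrix.linftyOpNormedRing Matrix.linftyOpNormedAlgebra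

theorem isUnit_map_of_isExpansive {d : ℕ} {R : Matrix (Fin d) (Fin d) ℤ} (hR : IsExpansive R) :
    IsUnit (R.map (Int.cast : ℤ → ℂ)) := by
  by_contra h
  have := hR 0 (spectrum.zero_mem_iff ℂ |>.2 h)
  simp at this
  linarith

theorem det_ne_zero_of_isExpansive {d : ℕ} {R : Matrix (Fin d) (Fin d) ℤ} (hR : IsExpansive R) :
    R.det ≠ 0 := by
  intro h
  have h1 := isUnit_map_of_isExpansive hR
  rw [Matrix.isUnit_iff_isUnit_det] at h1
  have h2 : (R.map (Int.cast : ℤ → ℂ)).det = ((R.det : ℤ) : ℂ) :=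
    ((Int.castRingHom ℂ).map_det R).symm
  rw [h2, h] at h1
  simp at h1

theorem invMat_map {d : ℕ} {R : Matrix (Fin d) (Fin d) ℤ} (hR : IsExpansive R) :
    (invMat R).map (Complex.ofReal) = (R.map (Int.cast : ℤ → ℂ))⁻¹ := by
  have hd := det_ne_zero_of_isExpansive hR
  have h2 : (R.map (Int.cast : ℤ → ℝ)).det = ((R.det : ℤ) : ℝ) :=
    ((Int.castRingHom ℝ).map_det R).symm
  have hu : IsUnit (R.map (Int.cast : ℤ → ℝ)).det := by
    rw [h2]; exact isUnit_iff_ne_zero.2 (by exact_mod_cast hd)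
  symm
  apply Matrix.inv_eq_right_inv
  have h3 : R.map (Int.cast : ℤ → ℂ) = (R.map (Int.cast : ℤ → ℝ)).map Complex.ofReal := by
    ext i j; simp
  rw [h3]
  have h4 := Matrix.mul_nonsing_inv _ hu
  have h5 := congrArg (fun M : Matrix (Fin d) (Fin d) ℝ => Complex.ofRealHom.mapMatrix M) h4
  simp only [map_mul, map_one] at h5
  exact h5

theorem summable_invMat_pow {d : ℕ} {R : Matrix (Fin d) (Fin d) ℤ} (hR : IsExpansive R)
    (i j : Fin d) : Summable fun k : ℕ => |((invMat R) ^ k) i j| := by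
  have : Nonempty (Fin d) := ⟨i⟩
  set A : Matrix (Fin d) (Fin d) ℂ := (R.map (Int.cast : ℤ → ℂ))⁻¹ with hA
  have hlt : spectralRadius ℂ A < (1 : NNReal) := by
    apply spectrum.spectralRadius_lt_of_forall_lt
    intro z hz
    obtain ⟨u, hu⟩ := isUnit_map_of_isExpansive hR
    have hAu : A = ((u⁻¹ : (Matrix (Fin d) (Fin d) ℂ)ˣ) : Matrix (Fin d) (Fin d) ℂ) := by
      rw [hA, ← hu, Matrix.coe_units_inv]
    have hz0 : z ≠ 0 := by
      rintro rfl
      rw [hAu] at hz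
      exact Units.zero_notMem_spectrum ℂ _ hz
    rw [hAu] at hz
    have h1 := (spectrum.inv_mem_iff (r := Units.mk0 z hz0) (a := u⁻¹)).1 hz
    rw [inv_inv, hu] at h1
    have h2 := hR _ h1
    simp only [Units.val_inv_eq_inv_val, Units.val_mk0, norm_inv] at h2
    have hzp : 0 < ‖z‖ := norm_pos_iff.2 hz0
    have h3 : ‖z‖ < 1 := by
      by_contra hcon
      have := inv_le_one_of_one_le₀ (not_lt.1 hcon)
      linarith
    exact_mod_cast h3
  obtain ⟨r, hr1, hr2⟩ := exists_between hlt
  have hg := spectrum.pow_nnnorm_pow_one_div_tendsto_nhds_spectralRadius A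
  have hev := hg.eventually_lt_const hr1
  have hrtop : r ≠ ⊤ := ne_top_of_lt hr2
  lift r to NNReal using hrtop
  have hr2' : (r : ℝ) < 1 := by exact_mod_cast hr2
  refine Summable.of_norm_bounded_eventually_nat
    (g := fun k => (r : ℝ) ^ k) (summable_geometric_of_lt_one r.2 hr2') ?_
  filter_upwards [hev, eventually_gt_atTop 0] with k hk hk0
  have h1 : ‖A ^ k‖₊ ≤ r ^ k := by
    have h2 : ((‖A ^ k‖₊ : ENNReal) ^ (1 / k : ℝ)) ^ (k : ℝ) ≤ (r : ENNReal) ^ (k : ℝ) :=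
      ENNReal.rpow_le_rpow hk.le (by positivity)
    rw [← ENNReal.rpow_mul, one_div, inv_mul_cancel₀ (by positivity), ENNReal.rpow_one,
      ENNReal.rpow_natCast] at h2
    exact_mod_cast h2
  have h3 : ‖(A ^ k) i j‖₊ ≤ ‖A ^ k‖₊ := by
    rw [Matrix.linfty_opNNNorm_def]
    exact (Finset.single_le_sum (f := fun j => ‖(A ^ k) i j‖₊) (fun _ _ => zero_le)
      (Finset.mem_univ j)).trans
      (Finset.le_sup (f := fun i => ∑ j, ‖(A ^ k) i j‖₊) (Finset.mem_univ i))
  have h4 : (A ^ k) i j = ((((invMat R) ^ k) i j : ℝ) : ℂ) := by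
    rw [hA, ← invMat_map hR]
    have := congrFun (congrFun (map_pow (Complex.ofRealHom.mapMatrix) (invMat R) k) i) j
    exact this.symm
  rw [h4] at h3
  have h5 : ‖((((invMat R) ^ k) i j : ℝ) : ℂ)‖ ≤ (r : ℝ) ^ k := by exact_mod_cast h3.trans h1
  simpa using h5

end Matrices

theorem measurable_ifsMap {d : ℕ} (R : Matrix (Fin d) (Fin d) ℤ) (b : Fin d → ℤ) :
    Measurable (ifsMap R b) := by
  have : Continuous (ifsMap R b) := by
    unfold ifsMap
    fun_prop
  exact this.measurable

theorem summable_mulVec_of_bounded {d : ℕ} {A : Matrix (Fin d) (Fin d) ℝ}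
    (hA : ∀ i j, Summable fun k : ℕ => |(A ^ k) i j|) (v : ℕ → Fin d → ℝ) (K : ℝ)
    (hK : ∀ k j, |v k j| ≤ K) : Summable fun k => (A ^ (k + 1)).mulVec (v k) := by
  rw [Pi.summable]
  intro i
  have h1 : Summable fun k : ℕ => ∑ j, |(A ^ (k + 1)) i j| * K := by
    refine summable_sum fun j _ => Summable.mul_right _ ?_
    exact (summable_nat_add_iff (f := fun k : ℕ => |(A ^ k) i j|) 1).2 (hA i j)
  refine Summable.of_norm_bounded h1 fun k => ?_
  rw [Real.norm_eq_abs, Matrix.mulVec, dotProduct]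
  refine (Finset.abs_sum_le_sum_abs _ _).trans (Finset.sum_le_sum fun j _ => ?_)
  rw [abs_mul]
  exact mul_le_mul_of_nonneg_left (hK _ _) (abs_nonneg _)

theorem exists_isSelfAffineMeasure {d : ℕ} {R : Matrix (Fin d) (Fin d) ℤ} (hR : IsExpansive R)
    {B : Finset (Fin d → ℤ)} (hB : B.Nonempty) : ∃ μ, IsSelfAffineMeasure R B μ := by
  have hN : (B.card : ENNReal) ≠ 0 := by simpa using hB.ne_empty
  set P : Measure B := ∑ b : B, (B.card : ENNReal)⁻¹ • Measure.dirac b with hP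
  have : IsProbabilityMeasure P := ⟨by
    simp [hP, ENNReal.mul_inv_cancel hN (ENNReal.natCast_ne_top _)]⟩
  set ν : Measure (ℕ → B) := Measure.infinitePi fun _ : ℕ => P with hν
  set A := invMat R with hA
  -- the coding map
  obtain ⟨K, hK⟩ : ∃ K : ℝ, ∀ b : B, ∀ j, |toReal b.1 j| ≤ K := by
    obtain ⟨K, hK⟩ := (Set.finite_range (fun p : B × Fin d => |toReal p.1.1 p.2|)).bddAbove
    exact ⟨K, fun b j => hK ⟨(b, j), rfl⟩⟩
  have hsum : ∀ ω : ℕ → B, Summable fun k => (A ^ (k + 1)).mulVec (toReal (ω k).1) :=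
    fun ω => summable_mulVec_of_bounded (summable_invMat_pow hR) _ K fun k j => hK _ j
  set X : (ℕ → B) → Fin d → ℝ := fun ω => ∑' k, (A ^ (k + 1)).mulVec (toReal (ω k).1) with hX
  have hXm : Measurable X := by
    refine measurable_of_tendsto_metrizable
      (f := fun n ω => ∑ k ∈ Finset.range n, (A ^ (k + 1)).mulVec (toReal (ω k).1)) ?_ ?_
    · intro n
      refine Finset.measurable_sum _ fun k _ => ?_
      exact (measurable_of_finite
        (fun b : B => (A ^ (k + 1)).mulVec (toReal b.1))).comp (measurable_pi_apply k)
    · rw [tendsto_pi_nhds]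
      intro ω
      exact (hsum ω).hasSum.tendsto_sum_nat
  set cons : B × (ℕ → B) → ℕ → B := fun p k => Nat.casesOn k p.1 fun k => p.2 k with hcons
  have hconsm : Measurable cons := by
    rw [measurable_pi_iff]
    rintro (_ | k)
    · exact measurable_fst
    · exact (measurable_pi_apply k).comp measurable_snd
  have hXcons : ∀ p, X (cons p) = ifsMap R p.1.1 (X p.2) := by
    intro p
    have h1 := (hsum p.2).hasSum
    have h2 := h1.map (A.mulVecLin) (LinearMap.continuous_of_finiteDimensional A.mulVecLin)
    rw [Matrix.mulVecLin_apply] at h2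
    have h3 : HasSum (fun k => (A ^ (k + 1 + 1)).mulVec (toReal (cons p (k + 1)).1))
        (A.mulVec (X p.2)) := by
      convert h2 using 2 with k
      simp only [Function.comp, Matrix.mulVecLin_apply, Matrix.mulVec_mulVec]
      rw [← pow_succ']
    have h4 := (hasSum_nat_add_iff (f := fun k => (A ^ (k + 1)).mulVec (toReal (cons p k).1)) 1).1
      h3
    have h5 := h4.tsum_eq
    simp only [hX] at h5 ⊢
    rw [h5, ifsMap, Matrix.mulVec_add]
    simp [hcons, hA]
  have hmap : (P.prod ν).map cons = ν := by
    refine Measure.eq_infinitePi (fun _ : ℕ => P) ?_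
    intro s t ht
    set t' : ℕ → Set B := fun i => if i ∈ s then t i else Set.univ with ht'
    have ht'm : ∀ i, MeasurableSet (t' i) := by
      intro i
      by_cases h : i ∈ s <;> simp [ht', h, ht i]
    obtain ⟨n, hn⟩ : ∃ n, s ⊆ Finset.range (n + 1) :=
      ⟨s.sup id, fun i hi => Finset.mem_range.2 (Nat.lt_succ_of_le (Finset.le_sup (f := id) hi))⟩
    have hbox : cons ⁻¹' (Set.pi s t) = t' 0 ×ˢ
        Set.pi (Finset.range n : Set ℕ) (fun i => t' (i + 1)) := by
      ext p
      simp only [Set.mem_preimage, Set.mem_pi, Set.mem_prod, Finset.mem_coe, Finset.mem_range]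
      constructor
      · intro h
        refine ⟨?_, fun i _ => ?_⟩
        · by_cases h0 : 0 ∈ s
          · simpa [ht', h0, hcons] using h 0 h0
          · simp [ht', h0]
        · by_cases h0 : i + 1 ∈ s
          · simpa [ht', h0] using h (i + 1) h0
          · simp [ht', h0]
      · rintro ⟨h0, h1⟩ (_ | i) hi
        · simpa [ht', hi, hcons] using h0
        · have := h1 i (by have := Finset.mem_range.1 (hn hi); omega)
          simpa [ht', hi] using this
    rw [Measure.map_apply hconsm (MeasurableSet.pi s.countable_toSet fun i _ => ht i), hbox,
      Measure.prod_prod, hν, Measure.infinitePi_pi _ (fun i _ => ht'm (i + 1))]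
    have h1 : ∏ i ∈ s, P (t i) = ∏ i ∈ Finset.range (n + 1), P (t' i) := by
      rw [← Finset.prod_subset hn]
      · refine Finset.prod_congr rfl fun i hi => ?_
        simp [ht', hi]
      · intro i _ hi
        simp [ht', hi]
    rw [h1, Finset.prod_range_succ', mul_comm]
  refine ⟨ν.map X, ?_, ?_⟩
  · exact Measure.isProbabilityMeasure_map hXm.aemeasurable
  · intro E hE
    have hpre : MeasurableSet (X ∘ cons ⁻¹' E) := (hXm.comp hconsm) hE
    have h1 : ν.map X E = (P.prod ν) (X ∘ cons ⁻¹' E) := by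
      rw [Measure.map_apply hXm hE]
      conv_lhs => rw [← hmap]
      rw [Measure.map_apply hconsm (hXm hE)]
      rfl
    rw [h1, Measure.prod_apply hpre, hP, lintegral_finsetSum_measure]
    rw [← Finset.sum_coe_sort B]
    refine Finset.sum_congr rfl fun b _ => ?_
    rw [lintegral_smul_measure, lintegral_dirac, smul_eq_mul,
      Measure.map_apply hXm (measurable_ifsMap R _ hE)]
    congr 2
    ext ω
    simp [hXcons]

theorem isSelfAffineMeasure_unique {d : ℕ} {R : Matrix (Fin d) (Fin d) ℤ} (hR : IsExpansive R)
    {B : Finset (Fin d → ℤ)} {μ ν : Measure (Fin d → ℝ)}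
    (hμ : IsSelfAffineMeasure R B μ) (hν : IsSelfAffineMeasure R B ν) : μ = ν := by
  have := hμ.1
  have := hν.1
  set A := invMat R with hA
  set φ : Measure (Fin d → ℝ) → (Fin d → ℝ) → ℂ :=
    fun ρ t => ∫ x, Complex.exp (((x ⬝ᵥ t : ℝ) : ℂ) * Complex.I) ∂ρ with hφ
  have hint : ∀ (ρ : Measure (Fin d → ℝ)) [IsProbabilityMeasure ρ] (g : (Fin d → ℝ) → ℝ),
      Continuous g → Integrable (fun x => Complex.exp ((g x : ℂ) * Complex.I)) ρ := by
    intro ρ _ g hg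
    refine Integrable.of_bound (C := 1) (by fun_prop) (Eventually.of_forall fun x => ?_)
    rw [Complex.norm_exp_ofReal_mul_I]
  have hfun : ∀ ρ : Measure (Fin d → ℝ), IsSelfAffineMeasure R B ρ → ∀ t,
      φ ρ t = (∑ b ∈ B, (B.card : ℂ)⁻¹ *
        Complex.exp (((A.mulVec (toReal b) ⬝ᵥ t : ℝ) : ℂ) * Complex.I)) *
          φ ρ (A.transpose.mulVec t) := by
    intro ρ hρ t
    have := hρ.1
    have hm : ρ = ∑ b ∈ B, (B.card : ENNReal)⁻¹ • ρ.map (ifsMap R b) := by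
      ext E hE
      rw [hρ.2 E hE, Measure.finsetSum_apply]
      refine Finset.sum_congr rfl fun b _ => ?_
      rw [Measure.smul_apply, Measure.map_apply (measurable_ifsMap R b) hE, smul_eq_mul]
    have hBne : B.Nonempty := by
      by_contra h
      rw [Finset.not_nonempty_iff_eq_empty] at h
      have h1 := hρ.2 Set.univ MeasurableSet.univ
      simp [h] at h1
    have hinvtop : (B.card : ENNReal)⁻¹ ≠ ⊤ := by simpa using hBne.ne_empty
    have hc : Continuous fun x : Fin d → ℝ =>
        Complex.exp (((x ⬝ᵥ t : ℝ) : ℂ) * Complex.I) := by fun_prop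
    have hdot : Continuous fun x : Fin d → ℝ => x ⬝ᵥ t := by fun_prop
    simp only [hφ]
    conv_lhs => rw [hm]
    rw [integral_finsetSum_measure]
    · rw [Finset.sum_mul]
      refine Finset.sum_congr rfl fun b _ => ?_
      rw [integral_smul_measure, integral_map (measurable_ifsMap R b).aemeasurable
        hc.aestronglyMeasurable]
      simp only [ENNReal.toReal_inv, ENNReal.toReal_natCast, Complex.real_smul]
      rw [mul_assoc]
      congr 1
      · simp
      · rw [← integral_const_mul]
        refine integral_congr_ae (Eventually.of_forall fun x => ?_)
        simp only
        rw [← Complex.exp_add, ← add_mul, ← Complex.ofReal_add]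
        congr 4
        rw [ifsMap, Matrix.mulVec_add, add_dotProduct, add_comm, ← hA]
        congr 1
        rw [Matrix.mulVec_transpose, dotProduct_comm, dotProduct_comm x,
          Matrix.dotProduct_mulVec]
    · intro b _
      have := Measure.isProbabilityMeasure_map (μ := ρ) (measurable_ifsMap R b).aemeasurable
      exact (hint _ _ hdot).smul_measure hinvtop
  have hle : ∀ t, ‖φ μ t - φ ν t‖ ≤
      ‖φ μ (A.transpose.mulVec t) - φ ν (A.transpose.mulVec t)‖ := by
    intro t
    rw [hfun μ hμ t, hfun ν hν t, ← mul_sub, norm_mul]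
    refine mul_le_of_le_one_left (norm_nonneg _) ?_
    refine (norm_sum_le _ _).trans ?_
    simp only [norm_mul, Complex.norm_exp_ofReal_mul_I, mul_one, norm_inv, Complex.norm_natCast,
      Finset.sum_const, nsmul_eq_mul]
    exact mul_inv_le_one
  have hle' : ∀ t (k : ℕ), ‖φ μ t - φ ν t‖ ≤
      ‖φ μ ((A.transpose ^ k).mulVec t) - φ ν ((A.transpose ^ k).mulVec t)‖ := by
    intro t k
    induction k with
    | zero => simp
    | succ k ih =>
      refine ih.trans ((hle _).trans (le_of_eq ?_))
      rw [Matrix.mulVec_mulVec, ← pow_succ']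
  have hcont : ∀ (ρ : Measure (Fin d → ℝ)) [IsProbabilityMeasure ρ], Continuous (φ ρ) := by
    intro ρ _
    refine continuous_of_dominated (bound := fun _ => 1) ?_ ?_ (integrable_const _) ?_
    · intro t
      exact (by fun_prop : Continuous _).aestronglyMeasurable
    · intro t
      exact Eventually.of_forall fun x => (Complex.norm_exp_ofReal_mul_I _).le
    · exact Eventually.of_forall fun x => by fun_prop
  have hzero : ∀ t, Tendsto (fun k : ℕ => (A.transpose ^ k).mulVec t) atTop (𝓝 0) := by
    intro t
    rw [tendsto_pi_nhds]
    intro i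
    have h1 : ∀ j, Tendsto (fun k : ℕ => (A.transpose ^ k) i j * t j) atTop (𝓝 (0 * t j)) := by
      intro j
      refine Tendsto.mul_const _ ?_
      have h2 := (summable_invMat_pow hR j i).tendsto_atTop_zero
      have h3 := (tendsto_zero_iff_abs_tendsto_zero _).2 h2
      refine h3.congr fun k => ?_
      rw [← Matrix.transpose_pow, Matrix.transpose_apply]
    have h4 := tendsto_finsetSum Finset.univ fun j _ => h1 j
    simpa [Matrix.mulVec, dotProduct] using h4
  have heq : ∀ t, φ μ t = φ ν t := by
    intro t
    have h1 : Tendsto (fun k : ℕ => ‖φ μ ((A.transpose ^ k).mulVec t) -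
        φ ν ((A.transpose ^ k).mulVec t)‖) atTop (𝓝 ‖φ μ 0 - φ ν 0‖) :=
      ((((hcont μ).tendsto 0).comp (hzero t)).sub (((hcont ν).tendsto 0).comp (hzero t))).norm
    have h2 : ‖φ μ 0 - φ ν 0‖ = 0 := by simp [hφ]
    rw [h2] at h1
    have h3 := ge_of_tendsto' h1 (hle' t)
    exact sub_eq_zero.1 (norm_le_zero_iff.1 h3)
  refine Measure.ext_of_charFunDual ?_
  ext L
  rw [charFunDual_apply, charFunDual_apply]
  have hL : ∀ x : Fin d → ℝ, L x = x ⬝ᵥ fun i => L (Pi.single i 1) := by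
    intro x
    conv_lhs => rw [pi_eq_sum_univ' x]
    rw [map_sum]
    simp [dotProduct]
  refine Eq.trans ?_ ((heq fun i => L (Pi.single i 1)).trans ?_)
  · exact integral_congr_ae (Eventually.of_forall fun x => by simp only [← hL x])
  · exact integral_congr_ae (Eventually.of_forall fun x => by simp only [← hL x])

theorem existsUnique_isSelfAffineMeasure {d : ℕ} {R : Matrix (Fin d) (Fin d) ℤ}
    (hR : IsExpansive R) {B : Finset (Fin d → ℤ)} (hB : B.Nonempty) :
    ∃! μ, IsSelfAffineMeasure R B μ := by
  obtain ⟨μ, hμ⟩ := exists_isSelfAffineMeasure hR hB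
  exact ⟨μ, hμ, fun ν hν => isSelfAffineMeasure_unique hR hν hμ⟩

theorem isSelfAffineMeasure_selfAffineMeasure {d : ℕ} {R : Matrix (Fin d) (Fin d) ℤ}
    (hR : IsExpansive R) {B : Finset (Fin d → ℤ)} (hB : B.Nonempty) :
    IsSelfAffineMeasure R B (selfAffineMeasure R B) := by
  have h := exists_isSelfAffineMeasure hR hB
  rw [selfAffineMeasure, dif_pos h]
  exact h.choose_spec

end

end SelfAffine

namespace SelfAffine

/-! Since the digits are simple, `B_n` has `N^n` elements and `μ` is the average of its images under
the maps `x ↦ R^{-n}(x + b)`, `b ∈ B_n`. A Fourier coefficient of `f` at `l` thus becomes an average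
over `x` of trigonometric sums with weights `w x b = f (R^{-n}(x + b))`, the setting of the discrete
inequalities.

Upper bound: apply Jensen, then the discrete inequality at each `x` (`sum_norm_blockCoeff_sq_le`).
Lower bound: if the weights do not depend on `x`, the coefficient is a trigonometric sum times
`μ̂((Rᵀ)^{-n} l)`, which `δ` controls. For `f` continuous with compact support, freeze the weights
at `x = 0`; the upper bound, applied to the difference of weights, shows that the error vanishes as
`n → ∞`, because `R^{-n} x → 0`. Density in `L²(μ)` completes `IsSelfAffineMeasure.hasFrameBounds`.
Weights are indexed by digit sums and need not come from step functions, so possible overlaps of the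
cells do not matter.

Towers: digit expansions split the trigonometric sum of level `m + n` into two of levels `m` and
`n`, so frame bounds multiply (`DiscreteFrame.add`). Summability of `ε` keeps the products of the
bounds away from `0` and `∞`.

To obtain `δ > 0`, move each `j ∈ J` by an element of `(Rᵀ)^n ℤ^d`. This leaves the discrete sums
alone but translates the argument of `μ̂` by an integer vector. As `𝒵` is empty, compactness of the
unit cube yields a translation making `μ̂` bounded below on a ball of fixed radius; at a high enough
level the earlier frequencies perturb the argument by less than that radius (`exists_step`). -/

/-- The character `t ↦ e^{-2π i t}`. -/
noncomputable def phase (t : ℝ) : ℂ := Complex.exp (-2 * Real.pi * Complex.I * (t : ℂ))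

theorem phase_add (s t : ℝ) : phase (s + t) = phase s * phase t := by
  rw [phase, phase, phase, ← Complex.exp_add]
  push_cast
  ring_nf

@[simp] theorem norm_phase (t : ℝ) : ‖phase t‖ = 1 := by
  have : phase t = Complex.exp (((-2 * Real.pi * t : ℝ) : ℂ) * Complex.I) := by
    rw [phase]
    push_cast
    ring_nf
  rw [this, Complex.norm_exp_ofReal_mul_I]

@[simp] theorem phase_zero : phase 0 = 1 := by simp [phase]

@[simp] theorem phase_intCast (k : ℤ) : phase k = 1 := by
  rw [phase, Complex.exp_eq_one_iff]
  exact ⟨-k, by push_cast; ring⟩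

theorem phase_mul_phase_neg (t : ℝ) : phase t * phase (-t) = 1 := by
  rw [← phase_add, add_neg_cancel, phase_zero]

@[fun_prop] theorem continuous_phase : Continuous phase := by
  unfold phase
  fun_prop

/-! ### Integer vectors and powers of `R` -/

variable {d : ℕ} {R : Matrix (Fin d) (Fin d) ℤ} {B : Finset (Fin d → ℤ)}

@[simp] theorem toReal_zero : toReal (0 : Fin d → ℤ) = 0 := by
  ext i
  simp [toReal]

theorem toReal_add (v w : Fin d → ℤ) : toReal (v + w) = toReal v + toReal w := by
  ext i
  simp [toReal]

theorem toReal_sub (v w : Fin d → ℤ) : toReal (v - w) = toReal v - toReal w := by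
  ext i
  simp [toReal]

theorem toReal_injective : Function.Injective (toReal (d := d)) := by
  intro v w h
  ext i
  have := congrFun h i
  simpa [toReal] using this

theorem toReal_dotProduct (v w : Fin d → ℤ) : toReal v ⬝ᵥ toReal w = ((v ⬝ᵥ w : ℤ) : ℝ) := by
  simp [toReal, dotProduct]

theorem toReal_mulVec (M : Matrix (Fin d) (Fin d) ℤ) (v : Fin d → ℤ) :
    toReal (M.mulVec v) = (M.map (Int.cast : ℤ → ℝ)).mulVec (toReal v) := by
  ext i
  simp [toReal, Matrix.mulVec, dotProduct]

theorem map_intCast_pow (M : Matrix (Fin d) (Fin d) ℤ) (n : ℕ) :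
    (M ^ n).map (Int.cast : ℤ → ℝ) = M.map (Int.cast : ℤ → ℝ) ^ n :=
  map_pow (Int.castRingHom ℝ).mapMatrix M n

theorem isUnit_det_map (hd : R.det ≠ 0) : IsUnit (R.map (Int.cast : ℤ → ℝ)).det := by
  have h2 : (R.map (Int.cast : ℤ → ℝ)).det = ((R.det : ℤ) : ℝ) :=
    ((Int.castRingHom ℝ).map_det R).symm
  rw [h2]
  exact isUnit_iff_ne_zero.2 (by exact_mod_cast hd)

theorem invMat_pow_mul_map_pow (hd : R.det ≠ 0) (n : ℕ) :
    invMat R ^ n * R.map (Int.cast : ℤ → ℝ) ^ n = 1 := by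
  have h : invMat R * R.map (Int.cast : ℤ → ℝ) = 1 := Matrix.nonsing_inv_mul _ (isUnit_det_map hd)
  have h' : R.map (Int.cast : ℤ → ℝ) * invMat R = 1 := Matrix.mul_nonsing_inv _ (isUnit_det_map hd)
  rw [← (show Commute _ _ from h.trans h'.symm).mul_pow, h, one_pow]

theorem map_pow_mul_invMat_pow (hd : R.det ≠ 0) (n : ℕ) :
    R.map (Int.cast : ℤ → ℝ) ^ n * invMat R ^ n = 1 :=
  mul_eq_one_comm.1 (invMat_pow_mul_map_pow hd n)

theorem invMat_pow_add_mulVec (hd : R.det ≠ 0) (m n : ℕ) (v : Fin d → ℤ) :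
    (invMat R ^ (m + n)).mulVec (toReal ((R ^ n).mulVec v)) =
      (invMat R ^ m).mulVec (toReal v) := by
  rw [toReal_mulVec, map_intCast_pow, Matrix.mulVec_mulVec, pow_add, mul_assoc,
    invMat_pow_mul_map_pow hd, mul_one]

theorem transpose_invMat_pow_add_mulVec (hd : R.det ≠ 0) (m n : ℕ) (v : Fin d → ℤ) :
    ((invMat R).transpose ^ (m + n)).mulVec (toReal ((R.transpose ^ m).mulVec v)) =
      ((invMat R).transpose ^ n).mulVec (toReal v) := by
  rw [toReal_mulVec, map_intCast_pow, Matrix.mulVec_mulVec, add_comm m, pow_add, mul_assoc,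
    Matrix.transpose_map, ← Matrix.transpose_pow _ m, ← Matrix.transpose_pow _ m,
    ← Matrix.transpose_mul, map_pow_mul_invMat_pow hd, Matrix.transpose_one, mul_one]

theorem invMat_pow_mulVec_dotProduct (n : ℕ) (x y : Fin d → ℝ) :
    (invMat R ^ n).mulVec x ⬝ᵥ y = x ⬝ᵥ ((invMat R).transpose ^ n).mulVec y := by
  rw [← Matrix.transpose_pow, Matrix.mulVec_transpose, dotProduct_comm, dotProduct_comm x,
    Matrix.dotProduct_mulVec]

/-- For `n = 0` and integral `x` the pairing is an integer, so its phase is `1`. This makes the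
characters on `B_m` periodic modulo `(Rᵀ)^m ℤ^d`. -/
theorem invMat_pow_add_mulVec_dotProduct (hd : R.det ≠ 0) (m n : ℕ) (x : Fin d → ℝ)
    (j : Fin d → ℤ) :
    (invMat R ^ (m + n)).mulVec x ⬝ᵥ toReal ((R.transpose ^ m).mulVec j) =
      (invMat R ^ n).mulVec x ⬝ᵥ toReal j := by
  rw [invMat_pow_mulVec_dotProduct, transpose_invMat_pow_add_mulVec hd,
    invMat_pow_mulVec_dotProduct]

theorem mulVec_pow_injective (hd : R.det ≠ 0) (n : ℕ) :
    Function.Injective (R ^ n).mulVec := by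
  intro v w h
  have h1 := invMat_pow_add_mulVec hd 0 n v
  have h2 := invMat_pow_add_mulVec hd 0 n w
  simp only [h] at h1
  rw [h1] at h2
  simpa using toReal_injective (by simpa using h2)

/-! ### Digit sums -/

theorem mem_digitSums {n : ℕ} {v : Fin d → ℤ} : v ∈ digitSums R B n ↔
    ∃ b : Fin n → Fin d → ℤ, (∀ i, b i ∈ B) ∧ ∑ j : Fin n, (R ^ (j : ℕ)).mulVec (b j) = v := by
  simp [digitSums]

@[simp] theorem digitSums_zero : digitSums R B 0 = {0} := by
  ext v
  simp [mem_digitSums, eq_comm]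

@[simp] theorem digitSums_one : digitSums R B 1 = B := by
  ext v
  simp only [mem_digitSums, Fin.forall_fin_one, Fin.sum_univ_one, Fin.val_zero, pow_zero,
    Matrix.one_mulVec]
  exact ⟨fun ⟨b, hb, h⟩ => h ▸ hb, fun h => ⟨fun _ => v, h, rfl⟩⟩

theorem digitSums_add (n m : ℕ) : digitSums R B (n + m) =
    (digitSums R B n ×ˢ digitSums R B m).image fun p => p.1 + (R ^ n).mulVec p.2 := by
  ext v
  simp only [Finset.mem_image, Finset.mem_product, Prod.exists]
  constructor
  · intro hv
    obtain ⟨b, hb, rfl⟩ := mem_digitSums.1 hv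
    refine ⟨∑ j : Fin n, (R ^ (j : ℕ)).mulVec (b (Fin.castAdd m j)),
      ∑ j : Fin m, (R ^ (j : ℕ)).mulVec (b (Fin.natAdd n j)),
      ⟨mem_digitSums.2 ⟨_, fun i => hb _, rfl⟩, mem_digitSums.2 ⟨_, fun i => hb _, rfl⟩⟩, ?_⟩
    rw [Fin.sum_univ_add, Matrix.mulVec_sum]
    simp [Matrix.mulVec_mulVec, pow_add]
  · rintro ⟨x, y, ⟨hx, hy⟩, rfl⟩
    obtain ⟨b, hb, rfl⟩ := mem_digitSums.1 hx
    obtain ⟨c, hc, rfl⟩ := mem_digitSums.1 hy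
    refine mem_digitSums.2 ⟨Fin.append b c, fun i => ?_, ?_⟩
    · refine Fin.addCases (fun i => ?_) (fun i => ?_) i <;> simp [hb, hc]
    · rw [Fin.sum_univ_add, Matrix.mulVec_sum]
      simp [Matrix.mulVec_mulVec, pow_add]

/-- Reduction modulo `R` identifies the lowest digits; cancelling them and one factor `R` leaves the
statement for `n`. Uniqueness of digit expansions follows. -/
theorem eq_of_mem_digitSums_of_sub_eq (hd : R.det ≠ 0) (hB : IsSimpleDigitSet R B) (n : ℕ) :
    ∀ {b c k : Fin d → ℤ}, b ∈ digitSums R B n → c ∈ digitSums R B n →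
      b - c = (R ^ n).mulVec k → b = c := by
  induction n with
  | zero =>
    intro b c k hb hc _
    simp only [digitSums_zero, Finset.mem_singleton] at hb hc
    rw [hb, hc]
  | succ n ih =>
    intro b c k hb hc h
    -- Writing `n + 1` as `1 + n` splits off the lowest digit rather than the highest.
    rw [add_comm, digitSums_add, Finset.mem_image] at hb hc
    obtain ⟨⟨β, b'⟩, hb', rfl⟩ := hb
    obtain ⟨⟨γ, c'⟩, hc', rfl⟩ := hc
    simp only [digitSums_one, Finset.mem_product, pow_one] at hb' hc' h ⊢
    have h1 : β - γ = R.mulVec ((R ^ n).mulVec k - (b' - c')) := by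
      rw [Matrix.mulVec_sub, Matrix.mulVec_mulVec, ← pow_succ', ← h, Matrix.mulVec_sub]
      abel
    have h2 : β = γ := by
      by_contra hne
      exact hB β hb'.1 γ hc'.1 hne ⟨_, h1⟩
    subst h2
    rw [sub_self] at h1
    have h3 : (R ^ n).mulVec k - (b' - c') = 0 := by
      apply mulVec_pow_injective hd 1
      rw [pow_one, ← h1, Matrix.mulVec_zero]
    rw [ih hb'.2 hc'.2 (sub_eq_zero.1 h3).symm]

theorem sum_digitSums_add {M : Type*} [AddCommMonoid M] (hd : R.det ≠ 0)
    (hB : IsSimpleDigitSet R B) (n m : ℕ) (f : (Fin d → ℤ) → M) :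
    ∑ b ∈ digitSums R B (n + m), f b =
      ∑ b ∈ digitSums R B n, ∑ c ∈ digitSums R B m, f (b + (R ^ n).mulVec c) := by
  rw [digitSums_add, Finset.sum_image, Finset.sum_product]
  rintro ⟨b, c⟩ hp ⟨b', c'⟩ hp' h
  simp only [Finset.coe_product, Set.mem_prod, Finset.mem_coe] at hp hp' h
  have h1 : b = b' := eq_of_mem_digitSums_of_sub_eq hd hB n (k := c' - c) hp.1 hp'.1 (by
    rw [Matrix.mulVec_sub, sub_eq_sub_iff_add_eq_add, h, add_comm])
  subst h1
  rw [mulVec_pow_injective hd n (add_left_cancel h)]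

theorem card_digitSums (hd : R.det ≠ 0) (hB : IsSimpleDigitSet R B) (n : ℕ) :
    (digitSums R B n).card = B.card ^ n := by
  induction n with
  | zero => simp
  | succ n ih =>
    rw [Finset.card_eq_sum_ones, sum_digitSums_add hd hB]
    simp [ih, pow_succ]

/-! ### Discrete frames and their products -/

/-- The trigonometric sum `∑_{b ∈ B_n} w_b e^{-2π i ⟨R^{-n} b, l⟩}`. -/
noncomputable def trigSum (R : Matrix (Fin d) (Fin d) ℤ) (B : Finset (Fin d → ℤ)) (n : ℕ)
    (w : (Fin d → ℤ) → ℂ) (l : Fin d → ℤ) : ℂ :=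
  ∑ b ∈ digitSums R B n, w b * phase ((invMat R ^ n).mulVec (toReal b) ⬝ᵥ toReal l)

/-- The discrete frame inequalities with bounds `a` and `c` at level `n`. -/
def DiscreteFrame (R : Matrix (Fin d) (Fin d) ℤ) (B : Finset (Fin d → ℤ)) (a c : ℝ) (n : ℕ)
    (J : Finset (Fin d → ℤ)) : Prop :=
  ∀ w : (Fin d → ℤ) → ℂ,
    a * ∑ b ∈ digitSums R B n, ‖w b‖ ^ 2 ≤
      ((B.card : ℝ) ^ n)⁻¹ * ∑ l ∈ J, ‖trigSum R B n w l‖ ^ 2 ∧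
    ((B.card : ℝ) ^ n)⁻¹ * ∑ l ∈ J, ‖trigSum R B n w l‖ ^ 2 ≤
      c * ∑ b ∈ digitSums R B n, ‖w b‖ ^ 2

theorem isAlmostParseval_iff {ε : ℝ} {n : ℕ} {J : Finset (Fin d → ℤ)} :
    IsAlmostParseval R B ε n J ↔ DiscreteFrame R B (1 - ε) (1 + ε) n J := by
  refine forall_congr' fun w => ?_
  have h : ∀ z : ℂ, ‖((Real.sqrt ((B.card : ℝ) ^ n) : ℝ) : ℂ)⁻¹ * z‖ ^ 2 =
      ((B.card : ℝ) ^ n)⁻¹ * ‖z‖ ^ 2 := by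
    intro z
    rw [norm_mul, norm_inv, Complex.norm_real, mul_pow, inv_pow, Real.norm_eq_abs, sq_abs,
      Real.sq_sqrt (by positivity)]
  simp only [h, ← Finset.mul_sum]
  rfl

/-- The elements of `J` are pairwise incongruent modulo `(Rᵀ)^n ℤ^d`. -/
def IncongruentMod (R : Matrix (Fin d) (Fin d) ℤ) (n : ℕ) (J : Finset (Fin d → ℤ)) : Prop :=
  ∀ j ∈ J, ∀ j' ∈ J, ∀ k, j - j' = (R.transpose ^ n).mulVec k → j = j'

theorem trigSum_add_transpose_mulVec (hd : R.det ≠ 0) (n : ℕ) (w : (Fin d → ℤ) → ℂ)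
    (l k : Fin d → ℤ) :
    trigSum R B n w (l + (R.transpose ^ n).mulVec k) = trigSum R B n w l := by
  refine Finset.sum_congr rfl fun b _ => ?_
  have h := invMat_pow_add_mulVec_dotProduct hd n 0 (toReal b) k
  rw [add_zero, pow_zero, Matrix.one_mulVec, toReal_dotProduct] at h
  rw [toReal_add, dotProduct_add, h, phase_add, phase_intCast, mul_one]

theorem trigSum_sub (n : ℕ) (w : (Fin d → ℤ) → ℂ) (l j : Fin d → ℤ) :
    trigSum R B n w (l - j) =
      trigSum R B n
        (fun b => w b * phase (-((invMat R ^ n).mulVec (toReal b) ⬝ᵥ toReal j))) l := by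
  refine Finset.sum_congr rfl fun b _ => ?_
  rw [toReal_sub, dotProduct_sub, sub_eq_neg_add, phase_add, mul_assoc]

/-- Pairing `R^{-(m+n)}(b + R^n c)` with `l + (Rᵀ)^m j` gives four terms: one couples `b` and `l`,
one is the level `m` pairing of `c` and `l`, one the level `n` pairing of `b` and `j`, and the last
is the integer `c ⬝ᵥ j`. -/
theorem trigSum_add_level (hd : R.det ≠ 0) (hB : IsSimpleDigitSet R B) (m n : ℕ)
    (w : (Fin d → ℤ) → ℂ) (l j : Fin d → ℤ) :
    trigSum R B (m + n) w (l + (R.transpose ^ m).mulVec j) =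
      trigSum R B n (fun b => phase ((invMat R ^ (m + n)).mulVec (toReal b) ⬝ᵥ toReal l) *
        trigSum R B m (fun c => w (b + (R ^ n).mulVec c)) l) j := by
  rw [trigSum]
  -- The frequencies split as `m + n` but the digits as `n + m`: the low digits `b ∈ B_n` meet the
  -- high frequencies `j`.
  conv_lhs => rw [show digitSums R B (m + n) = digitSums R B (n + m) by rw [add_comm]]
  rw [sum_digitSums_add hd hB, trigSum]
  refine Finset.sum_congr rfl fun b _ => ?_
  rw [trigSum, Finset.mul_sum, Finset.sum_mul]
  refine Finset.sum_congr rfl fun c _ => ?_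
  rw [toReal_add, Matrix.mulVec_add, invMat_pow_add_mulVec hd, toReal_add, add_dotProduct,
    dotProduct_add, dotProduct_add, invMat_pow_add_mulVec_dotProduct hd]
  have h := invMat_pow_add_mulVec_dotProduct hd m 0 (toReal c) j
  rw [add_zero, pow_zero, Matrix.one_mulVec, toReal_dotProduct] at h
  rw [h]
  simp only [phase_add, phase_intCast]
  ring

/-- Test on the conjugate of the character at `j'`: both congruent frequencies resonate fully, so
the normalized sum is at least `2 N^n`, against the upper bound `c N^n`. -/
theorem DiscreteFrame.incongruentMod {a c : ℝ} {n : ℕ} {J : Finset (Fin d → ℤ)}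
    (h : DiscreteFrame R B a c n J) (hc : c < 2) (hd : R.det ≠ 0) (hB : IsSimpleDigitSet R B)
    (hBne : B.Nonempty) : IncongruentMod R n J := by
  intro j hj j' hj' k hk
  by_contra hne
  set w : (Fin d → ℤ) → ℂ :=
    fun b => phase (-((invMat R ^ n).mulVec (toReal b) ⬝ᵥ toReal j')) with hw
  have h1 : trigSum R B n w j' = (B.card : ℂ) ^ n := by
    rw [trigSum, Finset.sum_congr rfl fun b _ => show w b * _ = 1 by
      rw [mul_comm, hw, phase_mul_phase_neg]]
    simp [card_digitSums hd hB]
  have h2 : trigSum R B n w j = (B.card : ℂ) ^ n := by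
    rw [eq_add_of_sub_eq' hk, trigSum_add_transpose_mulVec hd, h1]
  have h3 := (h w).2
  have h4 : ∑ l ∈ ({j, j'} : Finset (Fin d → ℤ)), ‖trigSum R B n w l‖ ^ 2 ≤
      ∑ l ∈ J, ‖trigSum R B n w l‖ ^ 2 :=
    Finset.sum_le_sum_of_subset_of_nonneg (by simp [Finset.insert_subset_iff, hj, hj'])
      fun _ _ _ => by positivity
  rw [Finset.sum_pair hne, h1, h2] at h4
  simp only [hw, norm_phase, one_pow, Finset.sum_const, card_digitSums hd hB, norm_pow,
    Complex.norm_natCast, nsmul_eq_mul, mul_one, Nat.cast_pow] at h3 h4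
  have hN : (0 : ℝ) < (B.card : ℝ) ^ n := by
    have := hBne.card_pos
    positivity
  set N : ℝ := (B.card : ℝ) ^ n
  have h5 := (mul_le_mul_of_nonneg_left h4 (inv_nonneg.2 hN.le)).trans h3
  have h6 : N⁻¹ * (N ^ 2 + N ^ 2) = 2 * N := by
    field_simp
    ring
  rw [h6] at h5
  nlinarith

theorem injOn_add_transpose_mulVec (hd : R.det ≠ 0) {m : ℕ} {Λ J : Finset (Fin d → ℤ)}
    (hΛ : IncongruentMod R m Λ) :
    Set.InjOn (fun p : (Fin d → ℤ) × (Fin d → ℤ) => p.1 + (R.transpose ^ m).mulVec p.2)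
      (Λ ×ˢ J : Finset _) := by
  rintro ⟨l, j⟩ hp ⟨l', j'⟩ hp' h
  simp only [Finset.coe_product, Set.mem_prod, Finset.mem_coe] at hp hp' h
  have h1 : l = l' := hΛ l hp.1 l' hp'.1 (j' - j) (by
    rw [Matrix.mulVec_sub, sub_eq_sub_iff_add_eq_add, h, add_comm])
  subst h1
  have hd' : R.transpose.det ≠ 0 := by rwa [Matrix.det_transpose]
  rw [mulVec_pow_injective hd' m (add_left_cancel h)]

open scoped Pointwise in
theorem add_image_eq_image_product (m : ℕ) (Λ J : Finset (Fin d → ℤ)) :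
    Λ + J.image (R.transpose ^ m).mulVec =
      (Λ ×ˢ J).image fun p => p.1 + (R.transpose ^ m).mulVec p.2 := by
  ext v
  simp only [Finset.mem_add, Finset.mem_image, Finset.mem_product, Prod.exists]
  constructor
  · rintro ⟨l, hl, _, ⟨j, hj, rfl⟩, rfl⟩
    exact ⟨l, j, ⟨hl, hj⟩, rfl⟩
  · rintro ⟨l, j, ⟨hl, hj⟩, rfl⟩
    exact ⟨l, hl, _, ⟨j, hj, rfl⟩, rfl⟩

open scoped Pointwise in
theorem IncongruentMod.add {m n : ℕ} {Λ J : Finset (Fin d → ℤ)} (hd : R.det ≠ 0)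
    (hΛ : IncongruentMod R m Λ) (hJ : IncongruentMod R n J) :
    IncongruentMod R (m + n) (Λ + J.image (R.transpose ^ m).mulVec) := by
  rw [add_image_eq_image_product]
  intro v hv v' hv' k h
  obtain ⟨⟨l, j⟩, hp, rfl⟩ := Finset.mem_image.1 hv
  obtain ⟨⟨l', j'⟩, hp', rfl⟩ := Finset.mem_image.1 hv'
  simp only [Finset.mem_product] at hp hp' h ⊢
  rw [pow_add, ← Matrix.mulVec_mulVec] at h
  have h1 : l = l' := hΛ l hp.1 l' hp'.1 ((R.transpose ^ n).mulVec k - (j - j')) (by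
    rw [Matrix.mulVec_sub, ← h, Matrix.mulVec_sub]
    abel)
  subst h1
  have hd' : R.transpose.det ≠ 0 := by rwa [Matrix.det_transpose]
  have h2 : j = j' := hJ j hp.2 j' hp'.2 k (mulVec_pow_injective hd' m (by
    rw [← h, Matrix.mulVec_sub]
    abel))
  rw [h2]

-- Apply the bounds of `J` to `u l` for each fixed `l`, then exchange sums and apply those of `Λ` to
-- `v b` for each fixed `b`. The phase coupling `b` and `l` is unimodular and disappears in between.
-- Incongruence of `Λ` ensures that no frequency of the sumset is counted twice.
open scoped Pointwise in
theorem DiscreteFrame.add {a c a' c' : ℝ} {m n : ℕ} {Λ J : Finset (Fin d → ℤ)}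
    (hd : R.det ≠ 0) (hB : IsSimpleDigitSet R B) (hinj : IncongruentMod R m Λ)
    (hΛ : DiscreteFrame R B a c m Λ) (hJ : DiscreteFrame R B a' c' n J) (ha' : 0 ≤ a')
    (hc' : 0 ≤ c') :
    DiscreteFrame R B (a * a') (c * c') (m + n) (Λ + J.image (R.transpose ^ m).mulVec) := by
  intro w
  rw [add_image_eq_image_product, Finset.sum_image (injOn_add_transpose_mulVec hd hinj),
    Finset.sum_product]
  set v : (Fin d → ℤ) → (Fin d → ℤ) → ℂ :=
    fun b c => w (b + (R ^ n).mulVec c) with hv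
  set u : (Fin d → ℤ) → (Fin d → ℤ) → ℂ := fun l b =>
    phase ((invMat R ^ (m + n)).mulVec (toReal b) ⬝ᵥ toReal l) * trigSum R B m (v b) l with hu
  have hun : ∀ l b, ‖u l b‖ = ‖trigSum R B m (v b) l‖ := by
    intro l b
    rw [hu, norm_mul, norm_phase, one_mul]
  have hw : ∑ b ∈ digitSums R B (m + n), ‖w b‖ ^ 2 =
      ∑ b ∈ digitSums R B n, ∑ c ∈ digitSums R B m, ‖v b c‖ ^ 2 := by
    rw [add_comm m, sum_digitSums_add hd hB]
  have hsum : ((B.card : ℝ) ^ (m + n))⁻¹ * ∑ l ∈ Λ, ∑ j ∈ J,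
      ‖trigSum R B (m + n) w (l + (R.transpose ^ m).mulVec j)‖ ^ 2 =
      ((B.card : ℝ) ^ m)⁻¹ * ∑ l ∈ Λ, ((B.card : ℝ) ^ n)⁻¹ * ∑ j ∈ J,
        ‖trigSum R B n (u l) j‖ ^ 2 := by
    simp only [trigSum_add_level hd hB]
    rw [← Finset.mul_sum, pow_add, mul_inv, mul_assoc]
  have hswap : ∀ r : ℝ, ((B.card : ℝ) ^ m)⁻¹ * ∑ l ∈ Λ, r * ∑ b ∈ digitSums R B n, ‖u l b‖ ^ 2 =
      r * ∑ b ∈ digitSums R B n, ((B.card : ℝ) ^ m)⁻¹ * ∑ l ∈ Λ,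
        ‖trigSum R B m (v b) l‖ ^ 2 := by
    intro r
    simp only [hun]
    rw [← Finset.mul_sum, ← Finset.mul_sum, Finset.sum_comm]
    ring
  have hN : (0 : ℝ) ≤ ((B.card : ℝ) ^ m)⁻¹ := by positivity
  rw [hsum, hw]
  constructor
  · refine le_trans ?_ (mul_le_mul_of_nonneg_left
      (Finset.sum_le_sum fun l _ => (hJ (u l)).1) hN)
    rw [hswap, mul_comm a, mul_assoc, Finset.mul_sum]
    exact mul_le_mul_of_nonneg_left (Finset.sum_le_sum fun b _ => (hΛ (v b)).1) ha'
  · refine (mul_le_mul_of_nonneg_left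
      (Finset.sum_le_sum fun l _ => (hJ (u l)).2) hN).trans ?_
    rw [hswap, mul_comm c, mul_assoc, Finset.mul_sum _ _ c]
    exact mul_le_mul_of_nonneg_left (Finset.sum_le_sum fun b _ => (hΛ (v b)).2) hc'

theorem level_succ (n : ℕ → ℕ) (k : ℕ) : level n (k + 1) = level n k + n k :=
  Finset.sum_range_succ _ _

theorem discreteFrame_towerLevel (hd : R.det ≠ 0) (hB : IsSimpleDigitSet R B) {a c : ℕ → ℝ}
    {n : ℕ → ℕ} {J : ℕ → Finset (Fin d → ℤ)} (ha : ∀ k, 0 ≤ a k) (hc : ∀ k, 0 ≤ c k)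
    (hJ : ∀ k, DiscreteFrame R B (a k) (c k) (n k) (J k))
    (hJinj : ∀ k, IncongruentMod R (n k) (J k)) (k : ℕ) :
    IncongruentMod R (level n k) (towerLevel R n J k) ∧
      DiscreteFrame R B (∏ i ∈ Finset.range k, a i) (∏ i ∈ Finset.range k, c i) (level n k)
        (towerLevel R n J k) := by
  induction k with
  | zero =>
    constructor
    · intro j hj j' hj' _ _
      simp only [towerLevel, Finset.mem_singleton] at hj hj'
      rw [hj, hj']
    · intro w
      simp [level, towerLevel, trigSum]
  | succ k ih =>
    rw [level_succ, Finset.prod_range_succ, Finset.prod_range_succ, towerLevel]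
    exact ⟨ih.1.add hd (hJinj k), ih.2.add hd hB ih.1 (hJ k) (ha k) (hc k)⟩

/-! ### Modifying frequency sets and raising the level -/

theorem DiscreteFrame.mono {a c a' c' : ℝ} {n : ℕ} {J : Finset (Fin d → ℤ)}
    (h : DiscreteFrame R B a c n J) (ha : a' ≤ a) (hc : c ≤ c') :
    DiscreteFrame R B a' c' n J := fun w =>
  ⟨(mul_le_mul_of_nonneg_right ha (Finset.sum_nonneg fun _ _ => by positivity)).trans (h w).1,
    (h w).2.trans (mul_le_mul_of_nonneg_right hc (Finset.sum_nonneg fun _ _ => by positivity))⟩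

/-- A translation of all frequencies multiplies the weights by unimodular factors. It serves to
bring `0` into the frequency set. -/
theorem DiscreteFrame.image_sub {a c : ℝ} {n : ℕ} {J : Finset (Fin d → ℤ)}
    (h : DiscreteFrame R B a c n J) (j : Fin d → ℤ) :
    DiscreteFrame R B a c n (J.image (· - j)) := by
  intro w
  rw [Finset.sum_image fun _ _ _ _ h => sub_left_injective h]
  simp only [trigSum_sub]
  simpa using h fun b => w b * phase (-((invMat R ^ n).mulVec (toReal b) ⬝ᵥ toReal j))

/-- Moving the frequencies by elements of `(Rᵀ)^n ℤ^d` preserves the frame inequalities. -/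
theorem DiscreteFrame.image_add {a c : ℝ} {n : ℕ} {J : Finset (Fin d → ℤ)}
    (h : DiscreteFrame R B a c n J) (hd : R.det ≠ 0) (hinj : IncongruentMod R n J)
    (s : (Fin d → ℤ) → Fin d → ℤ) :
    DiscreteFrame R B a c n (J.image fun j => j + (R.transpose ^ n).mulVec (s j)) := by
  intro w
  rw [Finset.sum_image]
  · simp only [trigSum_add_transpose_mulVec hd]
    exact h w
  · intro j hj j' hj' he
    refine hinj j hj j' hj' (s j' - s j) ?_
    rw [Matrix.mulVec_sub, sub_eq_sub_iff_add_eq_add]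
    exact he.trans (add_comm _ _)

theorem DiscreteFrame.nonempty {a c : ℝ} {n : ℕ} {J : Finset (Fin d → ℤ)}
    (h : DiscreteFrame R B a c n J) (ha : 0 < a) (hd : R.det ≠ 0) (hB : IsSimpleDigitSet R B)
    (hBne : B.Nonempty) : J.Nonempty := by
  by_contra hJ
  rw [Finset.not_nonempty_iff_eq_empty] at hJ
  have h1 := (h fun _ => 1).1
  have := hBne.card_pos
  simp only [hJ, Finset.sum_empty, mul_zero, norm_one, one_pow, Finset.sum_const,
    card_digitSums hd hB, nsmul_eq_mul, mul_one, Nat.cast_pow] at h1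
  have : 0 < a * (B.card : ℝ) ^ n := by positivity
  linarith

theorem exists_pow_bounds {ε : ℝ} (hε : 0 < ε) (p : ℕ) :
    ∃ η : ℝ, 0 < η ∧ η < 1 ∧ 1 - ε ≤ (1 - η) ^ p ∧ (1 + η) ^ p ≤ 1 + ε := by
  have h1 : Tendsto (fun η : ℝ => (1 - η) ^ p) (𝓝[>] 0) (𝓝 ((1 - 0) ^ p)) :=
    ((by fun_prop : Continuous fun η : ℝ => (1 - η) ^ p).tendsto 0).mono_left nhdsWithin_le_nhds
  have h2 : Tendsto (fun η : ℝ => (1 + η) ^ p) (𝓝[>] 0) (𝓝 ((1 + 0) ^ p)) :=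
    ((by fun_prop : Continuous fun η : ℝ => (1 + η) ^ p).tendsto 0).mono_left nhdsWithin_le_nhds
  have e1 := h1.eventually_const_lt (u := 1 - ε) (by simp [hε])
  have e2 := h2.eventually_lt_const (u := 1 + ε) (by simp [hε])
  have e3 : ∀ᶠ η : ℝ in 𝓝[>] 0, η ∈ Set.Ioo (0 : ℝ) 1 := Ioo_mem_nhdsGT one_pos
  obtain ⟨η, hη1, hη2, hη3⟩ := (e1.and (e2.and e3)).exists
  exact ⟨η, hη3.1, hη3.2, hη1.le, hη2.le⟩

/-- Under the almost-Parseval-frame condition the level may be taken arbitrarily large, with `0`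
among the frequencies. -/
theorem AlmostParsevalFrameCondition.exists_ge (hAP : AlmostParsevalFrameCondition R B)
    (hd : R.det ≠ 0) (hB : IsSimpleDigitSet R B) (hBne : B.Nonempty) {ε : ℝ} (hε : 0 < ε)
    (hε1 : ε < 1) (n₀ : ℕ) :
    ∃ n, n₀ < n ∧ ∃ J : Finset (Fin d → ℤ), 0 ∈ J ∧ IncongruentMod R n J ∧
      DiscreteFrame R B (1 - ε) (1 + ε) n J := by
  obtain ⟨η, hη0, hη1, hl, hu⟩ := exists_pow_bounds hε (n₀ + 1)
  obtain ⟨n, hn, J, hJ⟩ := hAP η hη0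
  rw [isAlmostParseval_iff] at hJ
  -- Stack `n₀ + 1` copies of one block. The level is then `(n₀ + 1) n > n₀`, and the bounds are the
  -- powers for which `η` was chosen.
  have h1 := (discreteFrame_towerLevel hd hB (a := fun _ => 1 - η) (c := fun _ => 1 + η)
    (n := fun _ => n) (J := fun _ => J) (fun _ => by linarith) (fun _ => by linarith)
    (fun _ => hJ) (fun _ => hJ.incongruentMod (by linarith) hd hB hBne) (n₀ + 1)).2
  rw [Finset.prod_const, Finset.prod_const, Finset.card_range] at h1
  have h2 := h1.mono hl hu
  obtain ⟨j, hj⟩ := h2.nonempty (by linarith) hd hB hBne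
  have h3 : (0 : Fin d → ℤ) ∈ (towerLevel R (fun _ => n) (fun _ => J) (n₀ + 1)).image (· - j) :=
    Finset.mem_image.2 ⟨j, hj, sub_self j⟩
  refine ⟨level (fun _ => n) (n₀ + 1), ?_, _, h3,
    (h2.image_sub j).incongruentMod (by linarith) hd hB hBne, h2.image_sub j⟩
  simp only [level, Finset.sum_const, Finset.card_range, smul_eq_mul]
  nlinarith

variable {μ : Measure (Fin d → ℝ)}

/-! ### Iterated self-affinity -/

/-- The map `x ↦ R^{-n}(x + b)`. -/
noncomputable def levelMap (R : Matrix (Fin d) (Fin d) ℤ) (n : ℕ) (b : Fin d → ℤ)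
    (x : Fin d → ℝ) : Fin d → ℝ :=
  (invMat R ^ n).mulVec (x + toReal b)

@[fun_prop] theorem continuous_levelMap (n : ℕ) (b : Fin d → ℤ) : Continuous (levelMap R n b) := by
  unfold levelMap
  fun_prop

/-- The outer map contributes the highest digit, since `R^{-1} b = R^{-(n+1)} (R^n b)`. -/
theorem ifsMap_levelMap (hd : R.det ≠ 0) (n : ℕ) (b c : Fin d → ℤ) (x : Fin d → ℝ) :
    ifsMap R b (levelMap R n c x) = levelMap R (n + 1) (c + (R ^ n).mulVec b) x := by
  have h := invMat_pow_add_mulVec hd 1 n b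
  rw [add_comm, pow_one] at h
  rw [ifsMap, levelMap, levelMap, toReal_add, ← add_assoc, Matrix.mulVec_add,
    Matrix.mulVec_add _ (x + toReal c), h, Matrix.mulVec_mulVec, pow_succ']

theorem IsSelfAffineMeasure.apply_eq_sum (hμ : IsSelfAffineMeasure R B μ) (hd : R.det ≠ 0)
    (hB : IsSimpleDigitSet R B) (n : ℕ) {E : Set (Fin d → ℝ)} (hE : MeasurableSet E) :
    μ E = ∑ b ∈ digitSums R B n, ((B.card : ENNReal)⁻¹) ^ n * μ (levelMap R n b ⁻¹' E) := by
  induction n generalizing E with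
  | zero =>
    have : levelMap R 0 0 = id := by
      ext x
      simp [levelMap]
    simp [this]
  | succ n ih =>
    rw [hμ.2 E hE, sum_digitSums_add hd hB, Finset.sum_comm, digitSums_one]
    refine Finset.sum_congr rfl fun b _ => ?_
    rw [ih (measurable_ifsMap R b hE), Finset.mul_sum]
    refine Finset.sum_congr rfl fun c _ => ?_
    rw [pow_succ', mul_assoc, ← Set.preimage_comp]
    congr 3
    ext x
    rw [Set.mem_preimage, Set.mem_preimage, Function.comp_apply, ifsMap_levelMap hd]

theorem IsSelfAffineMeasure.eq_sum_map (hμ : IsSelfAffineMeasure R B μ) (hd : R.det ≠ 0)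
    (hB : IsSimpleDigitSet R B) (n : ℕ) :
    μ = ∑ b ∈ digitSums R B n, ((B.card : ENNReal)⁻¹) ^ n • μ.map (levelMap R n b) := by
  ext E hE
  rw [hμ.apply_eq_sum hd hB n hE, Measure.finsetSum_apply]
  refine Finset.sum_congr rfl fun b _ => ?_
  rw [Measure.smul_apply, Measure.map_apply (continuous_levelMap n b).measurable hE, smul_eq_mul]

theorem IsSelfAffineMeasure.integrable_comp_levelMap {F : Type*} [NormedAddCommGroup F]
    (hμ : IsSelfAffineMeasure R B μ) (hd : R.det ≠ 0)
    (hB : IsSimpleDigitSet R B) (n : ℕ) {f : (Fin d → ℝ) → F} (hf : StronglyMeasurable f)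
    (hfi : Integrable f μ) {b : Fin d → ℤ} (hb : b ∈ digitSums R B n) :
    Integrable (fun x => f (levelMap R n b x)) μ := by
  rw [hμ.eq_sum_map hd hB n, integrable_finsetSum_measure] at hfi
  have h0 : ((B.card : ENNReal)⁻¹) ^ n ≠ 0 := pow_ne_zero _ (by simp)
  -- In `ENNReal` the inverse of `0` is `⊤`; this case means `B = ∅`, for which invariance would
  -- give total mass `0`.
  by_cases htop : ((B.card : ENNReal)⁻¹) ^ n = ⊤
  · have hn : n ≠ 0 := by
      rintro rfl
      simp at htop
    have hB0 : B = ∅ := by simpa [hn] using htop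
    have h1 := hμ.2 Set.univ MeasurableSet.univ
    have := hμ.1
    simp [hB0] at h1
  · have h1 := (integrable_smul_measure h0 htop).1 (hfi b hb)
    exact (integrable_map_measure hf.aestronglyMeasurable
      (continuous_levelMap n b).measurable.aemeasurable).1 h1

theorem IsSelfAffineMeasure.integral_eq_sum {F : Type*} [NormedAddCommGroup F] [NormedSpace ℝ F]
    (hμ : IsSelfAffineMeasure R B μ) (hd : R.det ≠ 0)
    (hB : IsSimpleDigitSet R B) (n : ℕ) {f : (Fin d → ℝ) → F} (hf : StronglyMeasurable f)
    (hfi : Integrable f μ) :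
    ∫ x, f x ∂μ =
      ((B.card : ℝ) ^ n)⁻¹ • ∑ b ∈ digitSums R B n, ∫ x, f (levelMap R n b x) ∂μ := by
  have hfi' := hfi
  rw [hμ.eq_sum_map hd hB n, integrable_finsetSum_measure] at hfi'
  conv_lhs => rw [hμ.eq_sum_map hd hB n]
  rw [integral_finsetSum_measure hfi', Finset.smul_sum]
  refine Finset.sum_congr rfl fun b _ => ?_
  rw [integral_smul_measure, integral_map (continuous_levelMap n b).measurable.aemeasurable
    hf.aestronglyMeasurable]
  simp

/-! ### Block coefficients: from discrete sums to `L²(μ)` -/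

theorem norm_integral_sq_le {α : Type*} [MeasurableSpace α] {ν : Measure α}
    [IsProbabilityMeasure ν] {h : α → ℂ} (hh : MemLp h 2 ν) :
    ‖∫ x, h x ∂ν‖ ^ 2 ≤ ∫ x, ‖h x‖ ^ 2 ∂ν := by
  have hi : Integrable (fun x => ‖h x‖) ν := (hh.integrable one_le_two).norm
  have h2 : Integrable (fun x => ‖h x‖ ^ 2) ν := hh.norm.integrable_sq
  set m := ∫ x, ‖h x‖ ∂ν with hm
  -- The variance of `‖h‖` is nonnegative.
  have h0 : 0 ≤ ∫ x, (‖h x‖ - m) ^ 2 ∂ν := integral_nonneg fun x => sq_nonneg _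
  have h1 : ∫ x, (‖h x‖ - m) ^ 2 ∂ν = ∫ x, ‖h x‖ ^ 2 ∂ν - m ^ 2 := by
    have : ∀ x, (‖h x‖ - m) ^ 2 = ‖h x‖ ^ 2 - 2 * m * ‖h x‖ + m ^ 2 := fun x => by ring
    simp only [this]
    have h3 : Integrable (fun x => ‖h x‖ ^ 2 - 2 * m * ‖h x‖) ν := h2.sub (hi.const_mul _)
    rw [integral_add h3 (integrable_const _),
      integral_sub h2 (hi.const_mul _), integral_const_mul, ← hm]
    simp
    ring
  have h3 : ‖∫ x, h x ∂ν‖ ^ 2 ≤ m ^ 2 := by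
    gcongr
    exact norm_integral_le_integral_norm _
  linarith

/-- The coefficient at `l` of a family of weights `w x`, averaged against `μ`. For
`w x b = f (R^{-n}(x + b))` it is the Fourier coefficient of `f`, see
`integral_mul_phase_eq_blockCoeff`. -/
noncomputable def blockCoeff (R : Matrix (Fin d) (Fin d) ℤ) (B : Finset (Fin d → ℤ))
    (μ : Measure (Fin d → ℝ)) (n : ℕ) (w : (Fin d → ℝ) → (Fin d → ℤ) → ℂ) (l : Fin d → ℤ) : ℂ :=
  ∫ x, (((B.card : ℝ) ^ n)⁻¹ : ℝ) • (trigSum R B n (w x) l *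
    phase ((invMat R ^ n).mulVec x ⬝ᵥ toReal l)) ∂μ

theorem memLp_trigSum_mul_phase {n : ℕ} {w : (Fin d → ℝ) → (Fin d → ℤ) → ℂ}
    (hw : ∀ b ∈ digitSums R B n, MemLp (fun x => w x b) 2 μ) (l : Fin d → ℤ) :
    MemLp (fun x => (((B.card : ℝ) ^ n)⁻¹ : ℝ) • (trigSum R B n (w x) l *
      phase ((invMat R ^ n).mulVec x ⬝ᵥ toReal l))) 2 μ := by
  have h1 : MemLp (fun x => trigSum R B n (w x) l) 2 μ := by
    unfold trigSum
    exact memLp_finsetSum _ fun b hb => (hw b hb).mul_const _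
  have h2 : Continuous fun x : Fin d → ℝ => phase ((invMat R ^ n).mulVec x ⬝ᵥ toReal l) := by
    fun_prop
  have h3 : MemLp (fun x => trigSum R B n (w x) l *
      phase ((invMat R ^ n).mulVec x ⬝ᵥ toReal l)) 2 μ :=
    h1.of_le (h1.aestronglyMeasurable.mul h2.aestronglyMeasurable)
      (Eventually.of_forall fun x => by simp)
  exact h3.const_smul (((B.card : ℝ) ^ n)⁻¹ : ℝ)

/-- Jensen moves the square inside the integral, where the phase in `x` has modulus one and the
discrete bound applies for each `x`. The weights are arbitrary because the estimate is needed both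
for a function and for the error made by freezing it on cells. -/
theorem sum_norm_blockCoeff_sq_le [IsProbabilityMeasure μ] {a c : ℝ} {n : ℕ}
    {J : Finset (Fin d → ℤ)}
    (hJ : DiscreteFrame R B a c n J) {w : (Fin d → ℝ) → (Fin d → ℤ) → ℂ}
    (hw : ∀ b ∈ digitSums R B n, MemLp (fun x => w x b) 2 μ) :
    ∑ l ∈ J, ‖blockCoeff R B μ n w l‖ ^ 2 ≤
      c * (((B.card : ℝ) ^ n)⁻¹ * ∑ b ∈ digitSums R B n, ∫ x, ‖w x b‖ ^ 2 ∂μ) := by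
  set N : ℝ := ((B.card : ℝ) ^ n)⁻¹ with hN
  have hN0 : 0 ≤ N := by positivity
  have hL := fun l => memLp_trigSum_mul_phase (μ := μ) hw l
  have hsq : ∀ l x, ‖N • (trigSum R B n (w x) l *
      phase ((invMat R ^ n).mulVec x ⬝ᵥ toReal l))‖ ^ 2 =
      N * (N * ‖trigSum R B n (w x) l‖ ^ 2) := by
    intro l x
    rw [norm_smul, norm_mul, norm_phase, mul_one, Real.norm_of_nonneg hN0]
    ring
  have hi : ∀ l, Integrable (fun x => N * (N * ‖trigSum R B n (w x) l‖ ^ 2)) μ := by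
    intro l
    simp only [← hsq]
    exact (hL l).norm.integrable_sq
  have hiw : ∀ b ∈ digitSums R B n, Integrable (fun x => ‖w x b‖ ^ 2) μ :=
    fun b hb => (hw b hb).norm.integrable_sq
  calc ∑ l ∈ J, ‖blockCoeff R B μ n w l‖ ^ 2
      ≤ ∑ l ∈ J, ∫ x, N * (N * ‖trigSum R B n (w x) l‖ ^ 2) ∂μ :=
        Finset.sum_le_sum fun l _ => (norm_integral_sq_le (hL l)).trans_eq
          (integral_congr_ae (Eventually.of_forall fun x => hsq l x))
    _ = ∫ x, ∑ l ∈ J, N * (N * ‖trigSum R B n (w x) l‖ ^ 2) ∂μ :=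
        (integral_finsetSum _ fun l _ => hi l).symm
    _ ≤ ∫ x, N * (c * ∑ b ∈ digitSums R B n, ‖w x b‖ ^ 2) ∂μ := by
        refine integral_mono (integrable_finsetSum _ fun l _ => hi l)
          (((integrable_finsetSum _ hiw).const_mul _).const_mul _) fun x => ?_
        simp only [← Finset.mul_sum]
        exact mul_le_mul_of_nonneg_left (hJ (w x)).2 hN0
    _ = c * (N * ∑ b ∈ digitSums R B n, ∫ x, ‖w x b‖ ^ 2 ∂μ) := by
        rw [integral_const_mul, integral_const_mul, integral_finsetSum _ hiw]
        ring

theorem levelMap_dotProduct (n : ℕ) (b l : Fin d → ℤ) (x : Fin d → ℝ) :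
    toReal l ⬝ᵥ levelMap R n b x =
      (invMat R ^ n).mulVec (toReal b) ⬝ᵥ toReal l + (invMat R ^ n).mulVec x ⬝ᵥ toReal l := by
  rw [levelMap, dotProduct_comm, Matrix.mulVec_add, add_dotProduct, add_comm]

theorem IsSelfAffineMeasure.memLp_comp_levelMap (hμ : IsSelfAffineMeasure R B μ) (hd : R.det ≠ 0)
    (hB : IsSimpleDigitSet R B) (n : ℕ) {f : (Fin d → ℝ) → ℂ} (hf : StronglyMeasurable f)
    (hf2 : MemLp f 2 μ) {b : Fin d → ℤ} (hb : b ∈ digitSums R B n) :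
    MemLp (fun x => f (levelMap R n b x)) 2 μ := by
  have h1 : StronglyMeasurable fun x => f (levelMap R n b x) :=
    hf.comp_measurable (continuous_levelMap n b).measurable
  refine (memLp_two_iff_integrable_sq_norm h1.aestronglyMeasurable).2 ?_
  exact hμ.integrable_comp_levelMap hd hB n (f := fun x => ‖f x‖ ^ 2) (hf.norm.pow 2)
    hf2.norm.integrable_sq hb

theorem IsSelfAffineMeasure.integral_mul_phase_eq_blockCoeff (hμ : IsSelfAffineMeasure R B μ)
    (hd : R.det ≠ 0) (hB : IsSimpleDigitSet R B) (n : ℕ) {f : (Fin d → ℝ) → ℂ}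
    (hf : StronglyMeasurable f) (hf2 : MemLp f 2 μ) (l : Fin d → ℤ) :
    ∫ x, f x * phase (toReal l ⬝ᵥ x) ∂μ =
      blockCoeff R B μ n (fun x b => f (levelMap R n b x)) l := by
  have := hμ.1
  have hc : Continuous fun x : Fin d → ℝ => phase (toReal l ⬝ᵥ x) := by fun_prop
  have hm : StronglyMeasurable fun x => f x * phase (toReal l ⬝ᵥ x) := hf.mul hc.stronglyMeasurable
  have hi : Integrable (fun x => f x * phase (toReal l ⬝ᵥ x)) μ :=
    (hf2.integrable one_le_two).mono hm.aestronglyMeasurable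
      (Eventually.of_forall fun x => by simp)
  rw [hμ.integral_eq_sum hd hB n hm hi, blockCoeff, integral_smul, ← integral_finsetSum]
  · congr 2
    ext x
    rw [trigSum, Finset.sum_mul]
    refine Finset.sum_congr rfl fun b _ => ?_
    rw [levelMap_dotProduct, phase_add, mul_assoc]
  · intro b hb
    exact hμ.integrable_comp_levelMap hd hB n hm hi hb

theorem IsSelfAffineMeasure.sum_norm_fourier_sq_le (hμ : IsSelfAffineMeasure R B μ)
    (hd : R.det ≠ 0) (hB : IsSimpleDigitSet R B) {a c : ℝ} {n : ℕ} {J : Finset (Fin d → ℤ)}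
    (hJ : DiscreteFrame R B a c n J) {f : (Fin d → ℝ) → ℂ} (hf : StronglyMeasurable f)
    (hf2 : MemLp f 2 μ) :
    ∑ l ∈ J, ‖∫ x, f x * phase (toReal l ⬝ᵥ x) ∂μ‖ ^ 2 ≤ c * ∫ x, ‖f x‖ ^ 2 ∂μ := by
  have := hμ.1
  rw [hμ.integral_eq_sum hd hB n (f := fun x => ‖f x‖ ^ 2) (hf.norm.pow 2)
    hf2.norm.integrable_sq]
  simp only [hμ.integral_mul_phase_eq_blockCoeff hd hB n hf hf2]
  exact sum_norm_blockCoeff_sq_le hJ fun b hb => hμ.memLp_comp_levelMap hd hB n hf hf2 hb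

/-- With constant weights only the phase in `x` is integrated, and it produces `μ̂`; this is where
the Fourier transform of `μ` enters the lower bound. -/
theorem blockCoeff_const (n : ℕ) (w : (Fin d → ℤ) → ℂ) (l : Fin d → ℤ) :
    blockCoeff R B μ n (fun _ => w) l = (((B.card : ℝ) ^ n)⁻¹ : ℝ) • (trigSum R B n w l *
      fourierMeasure μ (((invMat R).transpose ^ n).mulVec (toReal l))) := by
  rw [blockCoeff, integral_smul, integral_const_mul]
  simp only [invMat_pow_mulVec_dotProduct]
  congr 2
  refine integral_congr_ae (Eventually.of_forall fun x => ?_)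
  simp only [phase]
  rw [dotProduct_comm]

/-- Lower estimate for weights that do not depend on the point. -/
theorem le_sum_norm_blockCoeff_const_sq {a c δ : ℝ} {n : ℕ} {J : Finset (Fin d → ℤ)}
    (hJ : DiscreteFrame R B a c n J) (hδ0 : 0 ≤ δ)
    (hδ : ∀ l ∈ J, δ ≤ ‖fourierMeasure μ (((invMat R).transpose ^ n).mulVec (toReal l))‖ ^ 2)
    (w : (Fin d → ℤ) → ℂ) :
    δ * a * (((B.card : ℝ) ^ n)⁻¹ * ∑ b ∈ digitSums R B n, ‖w b‖ ^ 2) ≤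
      ∑ l ∈ J, ‖blockCoeff R B μ n (fun _ => w) l‖ ^ 2 := by
  set N : ℝ := ((B.card : ℝ) ^ n)⁻¹ with hN
  have hN0 : 0 ≤ N := by positivity
  calc δ * a * (N * ∑ b ∈ digitSums R B n, ‖w b‖ ^ 2)
      = δ * N * (a * ∑ b ∈ digitSums R B n, ‖w b‖ ^ 2) := by ring
    _ ≤ δ * N * (N * ∑ l ∈ J, ‖trigSum R B n w l‖ ^ 2) :=
        mul_le_mul_of_nonneg_left (hJ w).1 (by positivity)
    _ = ∑ l ∈ J, N ^ 2 * ‖trigSum R B n w l‖ ^ 2 * δ := by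
        rw [← Finset.sum_mul, ← Finset.mul_sum]
        ring
    _ ≤ _ := by
        refine Finset.sum_le_sum fun l hl => ?_
        rw [blockCoeff_const, norm_smul, norm_mul, Real.norm_of_nonneg hN0, mul_pow, mul_pow,
          ← mul_assoc]
        exact mul_le_mul_of_nonneg_left (hδ l hl) (by positivity)

theorem blockCoeff_sub {n : ℕ} {w v : (Fin d → ℝ) → (Fin d → ℤ) → ℂ} [IsProbabilityMeasure μ]
    (hw : ∀ b ∈ digitSums R B n, MemLp (fun x => w x b) 2 μ)
    (hv : ∀ b ∈ digitSums R B n, MemLp (fun x => v x b) 2 μ) (l : Fin d → ℤ) :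
    blockCoeff R B μ n (fun x b => w x b - v x b) l =
      blockCoeff R B μ n w l - blockCoeff R B μ n v l := by
  rw [blockCoeff, blockCoeff, blockCoeff, ← integral_sub
    ((memLp_trigSum_mul_phase hw l).integrable one_le_two)
    ((memLp_trigSum_mul_phase hv l).integrable one_le_two)]
  congr 1
  ext x
  rw [← smul_sub, ← sub_mul]
  simp only [trigSum, ← Finset.sum_sub_distrib, sub_mul]

theorem sqrt_sum_norm_sq_le {ι : Type*} (s : Finset ι) (x y : ι → ℂ) :
    √(∑ i ∈ s, ‖x i‖ ^ 2) ≤ √(∑ i ∈ s, ‖y i‖ ^ 2) + √(∑ i ∈ s, ‖y i - x i‖ ^ 2) := by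
  have h := norm_sub_le (WithLp.toLp 2 fun i : s => y i : EuclideanSpace ℂ s)
    (WithLp.toLp 2 fun i : s => y i - x i)
  simp only [EuclideanSpace.norm_eq] at h
  rw [← Finset.sum_coe_sort s, ← Finset.sum_coe_sort s, ← Finset.sum_coe_sort s]
  simpa using h

/-! ### Shrinking cells and the lower estimate -/

theorem tendsto_pow_mulVec_zero {A : Matrix (Fin d) (Fin d) ℝ}
    (hA : ∀ i j, Tendsto (fun k : ℕ => (A ^ k) i j) atTop (𝓝 0)) (x : Fin d → ℝ) :
    Tendsto (fun k : ℕ => (A ^ k).mulVec x) atTop (𝓝 0) := by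
  rw [tendsto_pi_nhds]
  intro i
  have h := tendsto_finsetSum Finset.univ fun j _ => (hA i j).mul_const (x j)
  simpa [Matrix.mulVec, dotProduct] using h

theorem tendsto_invMat_pow_apply (hR : IsExpansive R) (i j : Fin d) :
    Tendsto (fun k : ℕ => (invMat R ^ k) i j) atTop (𝓝 0) :=
  (tendsto_zero_iff_abs_tendsto_zero _).2 (summable_invMat_pow hR i j).tendsto_atTop_zero

theorem tendsto_invMat_pow_mulVec (hR : IsExpansive R) (x : Fin d → ℝ) :
    Tendsto (fun k : ℕ => (invMat R ^ k).mulVec x) atTop (𝓝 0) :=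
  tendsto_pow_mulVec_zero (tendsto_invMat_pow_apply hR) x

theorem tendsto_transpose_invMat_pow_mulVec (hR : IsExpansive R) (x : Fin d → ℝ) :
    Tendsto (fun k : ℕ => ((invMat R).transpose ^ k).mulVec x) atTop (𝓝 0) := by
  refine tendsto_pow_mulVec_zero (fun i j => ?_) x
  simp only [← Matrix.transpose_pow, Matrix.transpose_apply]
  exact tendsto_invMat_pow_apply hR j i

theorem inv_mul_sum_digitSums_le (hd : R.det ≠ 0) (hB : IsSimpleDigitSet R B)
    (hBne : B.Nonempty) (n : ℕ) {f : (Fin d → ℤ) → ℝ} {t : ℝ} (hf : ∀ b, f b ≤ t) :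
    ((B.card : ℝ) ^ n)⁻¹ * ∑ b ∈ digitSums R B n, f b ≤ t := by
  have hN : (0 : ℝ) < (B.card : ℝ) ^ n := by
    have := hBne.card_pos
    positivity
  have h := Finset.sum_le_card_nsmul (digitSums R B n) f t fun b _ => hf b
  rw [card_digitSums hd hB, nsmul_eq_mul, Nat.cast_pow] at h
  calc _ ≤ ((B.card : ℝ) ^ n)⁻¹ * ((B.card : ℝ) ^ n * t) := by gcongr
    _ = t := by field_simp

/-- A uniformly continuous bounded function is, on average, close to its value at the base points
of the cells of level `n`. -/
theorem tendsto_oscillation {F : Type*} [NormedAddCommGroup F] (hR : IsExpansive R)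
    (hB : IsSimpleDigitSet R B) (hBne : B.Nonempty) [IsProbabilityMeasure μ]
    {G : (Fin d → ℝ) → F} (hG : UniformContinuous G) {M : ℝ} (hM : ∀ x, ‖G x‖ ≤ M) {q : ℕ}
    (hq : q ≠ 0) :
    Tendsto (fun n : ℕ => ((B.card : ℝ) ^ n)⁻¹ * ∑ b ∈ digitSums R B n,
      ∫ x, ‖G (levelMap R n b x) - G (levelMap R n b 0)‖ ^ q ∂μ) atTop (𝓝 0) := by
  have hd := det_ne_zero_of_isExpansive hR
  have hGc := hG.continuous
  have hbd : ∀ n b x, ‖G (levelMap R n b x) - G (levelMap R n b 0)‖ ^ q ≤ (2 * M) ^ q := by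
    intro n b x
    gcongr
    linarith [norm_sub_le (G (levelMap R n b x)) (G (levelMap R n b 0)),
      hM (levelMap R n b x), hM (levelMap R n b 0)]
  have hcont : ∀ n b, Continuous fun x =>
      ‖G (levelMap R n b x) - G (levelMap R n b 0)‖ ^ q := by
    intro n b
    fun_prop
  have hint : ∀ n b, Integrable (fun x =>
      ‖G (levelMap R n b x) - G (levelMap R n b 0)‖ ^ q) μ := by
    intro n b
    refine Integrable.of_bound (C := (2 * M) ^ q) (hcont n b).aestronglyMeasurable
      (Eventually.of_forall fun x => ?_)
    rw [Real.norm_of_nonneg (by positivity)]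
    exact hbd n b x
  -- Dominated convergence in `x`: for fixed `x` the displacement inside a cell is `R^{-n} x`, the
  -- same for every `b`, so uniform continuity of `G` handles all cells at once.
  have h1 : Tendsto (fun n : ℕ => ∫ x, ((B.card : ℝ) ^ n)⁻¹ * ∑ b ∈ digitSums R B n,
      ‖G (levelMap R n b x) - G (levelMap R n b 0)‖ ^ q ∂μ) atTop (𝓝 (∫ _, (0 : ℝ) ∂μ)) := by
    refine tendsto_integral_of_dominated_convergence (fun _ => (2 * M) ^ q) (fun n => ?_)
      (integrable_const _) (fun n => Eventually.of_forall fun x => ?_)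
      (Eventually.of_forall fun x => ?_)
    · exact (continuous_const.mul
        (continuous_finsetSum _ fun b _ => hcont n b)).aestronglyMeasurable
    · rw [Real.norm_of_nonneg (by positivity)]
      exact inv_mul_sum_digitSums_le hd hB hBne n fun b => hbd n b x
    · rw [Metric.tendsto_atTop]
      intro ε hε
      -- The bound `η ≤ 1` serves to get `η ^ q ≤ η`.
      obtain ⟨η, hη0, hηε, hη1⟩ : ∃ η : ℝ, 0 < η ∧ η < ε ∧ η ≤ 1 :=
        ⟨min (ε / 2) 1, by positivity, (min_le_left _ _).trans_lt (by linarith), min_le_right _ _⟩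
      obtain ⟨r, hr, hGr⟩ := Metric.uniformContinuous_iff.1 hG η hη0
      obtain ⟨n₀, hn₀⟩ := Metric.tendsto_atTop.1 (tendsto_invMat_pow_mulVec hR x) r hr
      refine ⟨n₀, fun n hn => ?_⟩
      rw [Real.dist_eq, sub_zero, abs_of_nonneg (by positivity)]
      refine (inv_mul_sum_digitSums_le hd hB hBne n fun b => ?_).trans_lt hηε
      have h2 : dist (levelMap R n b x) (levelMap R n b 0) < r := by
        have h3 : levelMap R n b x - levelMap R n b 0 = (invMat R ^ n).mulVec x := by
          rw [levelMap, levelMap, ← Matrix.mulVec_sub]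
          congr 1
          abel
        rw [dist_eq_norm, h3, ← dist_zero_right]
        exact hn₀ n hn
      have h4 := (hGr h2).le
      rw [dist_eq_norm] at h4
      calc _ ≤ η ^ q := by gcongr
        _ ≤ η := pow_le_of_le_one hη0.le hη1 hq
  rw [integral_zero] at h1
  refine h1.congr fun n => ?_
  rw [integral_const_mul, integral_finsetSum _ fun b _ => hint n b]

theorem IsSelfAffineMeasure.tendsto_average (hμ : IsSelfAffineMeasure R B μ)
    (hR : IsExpansive R) (hB : IsSimpleDigitSet R B) (hBne : B.Nonempty)
    {G : (Fin d → ℝ) → ℝ} (hG : UniformContinuous G) {M : ℝ} (hM : ∀ x, ‖G x‖ ≤ M) :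
    Tendsto (fun n : ℕ => ((B.card : ℝ) ^ n)⁻¹ * ∑ b ∈ digitSums R B n, G (levelMap R n b 0))
      atTop (𝓝 (∫ x, G x ∂μ)) := by
  have := hμ.1
  have hd := det_ne_zero_of_isExpansive hR
  have hGm := hG.continuous.stronglyMeasurable
  have hGi : Integrable G μ :=
    Integrable.of_bound (C := M) hGm.aestronglyMeasurable (Eventually.of_forall hM)
  refine tendsto_iff_norm_sub_tendsto_zero.2 (squeeze_zero (fun _ => norm_nonneg _) (fun n => ?_)
    (tendsto_oscillation hR hB hBne hG hM (μ := μ) one_ne_zero))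
  rw [norm_sub_rev, hμ.integral_eq_sum hd hB n hGm hGi, smul_eq_mul, ← mul_sub,
    ← Finset.sum_sub_distrib, norm_mul, Real.norm_of_nonneg (by positivity)]
  refine mul_le_mul_of_nonneg_left ((norm_sum_le _ _).trans
    (Finset.sum_le_sum fun b hb => ?_)) (by positivity)
  have h1 : ∫ x, G (levelMap R n b x) ∂μ - G (levelMap R n b 0) =
      ∫ x, (G (levelMap R n b x) - G (levelMap R n b 0)) ∂μ := by
    rw [integral_sub (hμ.integrable_comp_levelMap hd hB n hGm hGi hb) (integrable_const _)]
    simp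
  rw [h1]
  simpa using norm_integral_le_integral_norm (μ := μ)
    fun x => G (levelMap R n b x) - G (levelMap R n b 0)

/-- Compare the true coefficients with those of the weights frozen at `x = 0`. The frozen ones obey
the lower estimate, whose Riemann sums tend to `∫ ‖g‖²`; the discrepancy is the oscillation of `g`
on the cells and tends to `0`. -/
theorem IsSelfAffineMeasure.lower_bound_of_hasCompactSupport (hμ : IsSelfAffineMeasure R B μ)
    (hR : IsExpansive R) (hB : IsSimpleDigitSet R B) (hBne : B.Nonempty) {a c δ : ℝ}
    (hδ0 : 0 ≤ δ) {m : ℕ → ℕ} (hm : Tendsto m atTop atTop)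
    {Λ : ℕ → Finset (Fin d → ℤ)} (hΛ : ∀ k, DiscreteFrame R B a c (m k) (Λ k))
    (hδ : ∀ k, ∀ l ∈ Λ k,
      δ ≤ ‖fourierMeasure μ (((invMat R).transpose ^ m k).mulVec (toReal l))‖ ^ 2)
    {g : (Fin d → ℝ) → ℂ} (hg : Continuous g) (hgs : HasCompactSupport g) {S : ℝ} (hS0 : 0 ≤ S)
    (hS : ∀ k, ∑ l ∈ Λ k, ‖∫ x, g x * phase (toReal l ⬝ᵥ x) ∂μ‖ ^ 2 ≤ S) :
    δ * a * ∫ x, ‖g x‖ ^ 2 ∂μ ≤ S := by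
  have := hμ.1
  have hd := det_ne_zero_of_isExpansive hR
  obtain ⟨M, hM⟩ := hgs.exists_bound_of_continuous hg
  have hgu := hgs.uniformContinuous_of_continuous hg
  have hg2 : MemLp g 2 μ := MemLp.of_bound hg.aestronglyMeasurable M (Eventually.of_forall hM)
  have hsqc : Continuous fun x => ‖g x‖ ^ 2 := by fun_prop
  have hsqs : HasCompactSupport fun x => ‖g x‖ ^ 2 :=
    hgs.comp_left (g := fun z : ℂ => ‖z‖ ^ 2) (by simp)
  have hsqM : ∀ x, ‖‖g x‖ ^ 2‖ ≤ M ^ 2 := by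
    intro x
    rw [norm_pow, norm_norm]
    exact pow_le_pow_left₀ (norm_nonneg _) (hM x) 2
  have t1 := (hμ.tendsto_average hR hB hBne (hsqs.uniformContinuous_of_continuous hsqc) hsqM).comp
    hm
  have t2 := (tendsto_oscillation hR hB hBne hgu hM (μ := μ) two_ne_zero).comp hm
  have key : ∀ k, √(δ * a * (((B.card : ℝ) ^ m k)⁻¹ *
      ∑ b ∈ digitSums R B (m k), ‖g (levelMap R (m k) b 0)‖ ^ 2)) ≤
      √S + √(c * (((B.card : ℝ) ^ m k)⁻¹ * ∑ b ∈ digitSums R B (m k),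
        ∫ x, ‖g (levelMap R (m k) b x) - g (levelMap R (m k) b 0)‖ ^ 2 ∂μ)) := by
    intro k
    have hw : ∀ b ∈ digitSums R B (m k), MemLp (fun x => g (levelMap R (m k) b x)) 2 μ :=
      fun b hb => hμ.memLp_comp_levelMap hd hB _ hg.stronglyMeasurable hg2 hb
    have hv : ∀ b ∈ digitSums R B (m k),
        MemLp (fun _ : Fin d → ℝ => g (levelMap R (m k) b 0)) 2 μ := fun b _ => memLp_const _
    have e1 := le_sum_norm_blockCoeff_const_sq (hΛ k) hδ0 (hδ k)
      fun b => g (levelMap R (m k) b 0)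
    have e2 := sum_norm_blockCoeff_sq_le (hΛ k) fun b hb => (hw b hb).sub (hv b hb)
    have e3 := hS k
    simp only [hμ.integral_mul_phase_eq_blockCoeff hd hB (m k) hg.stronglyMeasurable hg2] at e3
    have e4 := sqrt_sum_norm_sq_le (Λ k)
      (blockCoeff R B μ (m k) fun _ b => g (levelMap R (m k) b 0))
      (blockCoeff R B μ (m k) fun x b => g (levelMap R (m k) b x))
    simp only [← blockCoeff_sub hw hv] at e4
    exact (Real.sqrt_le_sqrt e1).trans (e4.trans
      (add_le_add (Real.sqrt_le_sqrt e3) (Real.sqrt_le_sqrt e2)))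
  have h1 := le_of_tendsto_of_tendsto' ((t1.const_mul (δ * a)).sqrt)
    (((t2.const_mul c).sqrt).const_add (√S)) key
  rw [mul_zero, Real.sqrt_zero, add_zero] at h1
  exact (Real.sqrt_le_sqrt_iff hS0).1 h1

theorem norm_Lp_two_sq (f : Lp ℂ 2 μ) : ‖f‖ ^ 2 = ∫ x, ‖f x‖ ^ 2 ∂μ := by
  have h := @inner_self_eq_norm_sq ℂ _ _ _ _ f
  rw [← h, L2.inner_def]
  simp only [inner_self_eq_norm_sq_to_K]
  norm_cast

/-- Uniform discrete frame inequalities at levels tending to infinity, together with a lower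
bound for the Fourier transform, give frame bounds for the union of the frequency sets. -/
theorem IsSelfAffineMeasure.hasFrameBounds (hμ : IsSelfAffineMeasure R B μ)
    (hR : IsExpansive R) (hB : IsSimpleDigitSet R B) (hBne : B.Nonempty) {a c δ : ℝ}
    (ha : 0 ≤ a) (hc : 0 ≤ c) (hδ0 : 0 ≤ δ) {m : ℕ → ℕ} (hm : Tendsto m atTop atTop)
    {Λ : ℕ → Finset (Fin d → ℤ)} (hmono : Monotone Λ)
    (hΛ : ∀ k, DiscreteFrame R B a c (m k) (Λ k))
    (hδ : ∀ k, ∀ l ∈ Λ k,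
      δ ≤ ‖fourierMeasure μ (((invMat R).transpose ^ m k).mulVec (toReal l))‖ ^ 2)
    {Γ : Set (Fin d → ℤ)} (hΓ : ∀ l, l ∈ Γ ↔ ∃ k, l ∈ Λ k) :
    HasFrameBounds μ Γ (a * δ) c := by
  classical
  have := hμ.1
  have hd := det_ne_zero_of_isExpansive hR
  set co : ((Fin d → ℝ) → ℂ) → (Fin d → ℤ) → ℂ :=
    fun f l => ∫ x, f x * phase (toReal l ⬝ᵥ x) ∂μ with hco
  intro f
  have hf := Lp.stronglyMeasurable f
  have hf2 := Lp.memLp f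
  -- The `Λ k` are nested, so a finite set of frequencies sits in a single level and inherits its
  -- upper bound.
  have hsub : ∀ s : Finset Γ, ∃ k, ∀ l ∈ s, l.1 ∈ Λ k := by
    intro s
    choose k hk using fun l : Γ => (hΓ l.1).1 l.2
    exact ⟨s.sup k, fun l hl => hmono (Finset.le_sup hl) (hk l)⟩
  have hfin : ∀ s : Finset Γ, ∑ l ∈ s, ‖co f l.1‖ ^ 2 ≤ c * ‖f‖ ^ 2 := by
    intro s
    obtain ⟨k, hk⟩ := hsub s
    rw [norm_Lp_two_sq]
    refine le_trans ?_ (hμ.sum_norm_fourier_sq_le hd hB (hΛ k) hf hf2)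
    rw [← Finset.sum_image (f := fun l => ‖co f l‖ ^ 2) (g := Subtype.val)
      fun _ _ _ _ h => Subtype.ext h]
    refine Finset.sum_le_sum_of_subset_of_nonneg ?_ fun _ _ _ => by positivity
    intro l hl
    obtain ⟨l', hl', rfl⟩ := Finset.mem_image.1 hl
    exact hk l' hl'
  have hsum : Summable fun l : Γ => ‖co f l.1‖ ^ 2 :=
    summable_of_sum_le (fun _ => by positivity) hfin
  refine ⟨_, hsum.hasSum, ?_, hsum.tsum_le_of_sum_le hfin⟩
  set S := ∑' l : Γ, ‖co f l.1‖ ^ 2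
  have hS0 : 0 ≤ S := tsum_nonneg fun _ => by positivity
  have hlev : ∀ k, ∑ l ∈ Λ k, ‖co f l‖ ^ 2 ≤ S := by
    intro k
    rw [← Finset.sum_subtype_of_mem (p := (· ∈ Γ)) (fun l => ‖co f l‖ ^ 2)
      fun l hl => (hΓ l).2 ⟨k, hl⟩]
    exact hsum.sum_le_tsum _ fun _ _ => by positivity
  -- Approximate `f` within `η` by a compactly supported `g`. Passing from the coefficients of `f`
  -- to those of `g` costs `√c * η` by the upper bound; passing back from `‖g‖` to `‖f‖` costs `√(a
  -- * δ) * η`.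
  have happrox : ∀ η : ℝ, 0 < η → √(a * δ) * ‖f‖ ≤ √S + (√c + √(a * δ)) * η := by
    intro η hη
    obtain ⟨g, hgs, hfg, hgc, hg2⟩ := hf2.exists_hasCompactSupport_eLpNorm_sub_le
      ENNReal.ofNat_ne_top (ENNReal.ofReal_pos.2 hη).ne'
    have hfgm : MemLp (⇑f - g) 2 μ := hf2.sub hg2
    have hfg2 : ∫ x, ‖(⇑f - g) x‖ ^ 2 ∂μ ≤ η ^ 2 := by
      have h1 : ‖hfgm.toLp‖ ≤ η := by
        rw [Lp.norm_toLp]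
        exact ENNReal.toReal_le_of_le_ofReal hη.le hfg
      calc _ = ‖hfgm.toLp‖ ^ 2 := by
            rw [norm_Lp_two_sq]
            refine integral_congr_ae ?_
            filter_upwards [hfgm.coeFn_toLp] with x hx
            rw [hx]
        _ ≤ η ^ 2 := pow_le_pow_left₀ (norm_nonneg _) h1 2
    have hint : ∀ {h : (Fin d → ℝ) → ℂ}, MemLp h 2 μ → ∀ l : Fin d → ℤ,
        Integrable (fun x => h x * phase (toReal l ⬝ᵥ x)) μ := by
      intro h hh l
      have hp : Continuous fun x : Fin d → ℝ => phase (toReal l ⬝ᵥ x) := by fun_prop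
      exact (hh.integrable one_le_two).mono
        (hh.aestronglyMeasurable.mul hp.aestronglyMeasurable)
        (Eventually.of_forall fun x => by simp)
    have hcosub : ∀ l, co (⇑f - g) l = co f l - co g l := by
      intro l
      simp only [hco]
      rw [← integral_sub (hint hf2 l) (hint hg2 l)]
      simp only [Pi.sub_apply, sub_mul]
    have hgl : ∀ k, ∑ l ∈ Λ k, ‖co g l‖ ^ 2 ≤ (√S + √c * η) ^ 2 := by
      intro k
      have e1 := sqrt_sum_norm_sq_le (Λ k) (co g) (co f)
      simp only [← hcosub] at e1
      have e2 := hμ.sum_norm_fourier_sq_le hd hB (hΛ k) (hf.sub hgc.stronglyMeasurable) hfgm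
      have e3 : √(∑ l ∈ Λ k, ‖co (⇑f - g) l‖ ^ 2) ≤ √c * η := by
        refine (Real.sqrt_le_sqrt (e2.trans (mul_le_mul_of_nonneg_left hfg2 hc))).trans_eq ?_
        rw [Real.sqrt_mul hc, Real.sqrt_sq hη.le]
      have e4 := Real.sqrt_le_sqrt (hlev k)
      rw [← Real.sqrt_le_left (by positivity)]
      linarith
    have hlow := hμ.lower_bound_of_hasCompactSupport hR hB hBne hδ0 hm hΛ hδ hgc hgs
      (by positivity) hgl
    have hgn : ∫ x, ‖g x‖ ^ 2 ∂μ = ‖hg2.toLp‖ ^ 2 := by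
      rw [norm_Lp_two_sq]
      refine integral_congr_ae ?_
      filter_upwards [hg2.coeFn_toLp] with x hx
      rw [hx]
    rw [hgn, mul_comm δ] at hlow
    have h1 := Real.sqrt_le_sqrt hlow
    rw [Real.sqrt_mul (by positivity), Real.sqrt_sq (norm_nonneg _),
      Real.sqrt_sq (by positivity)] at h1
    have h2 : ‖f‖ ≤ ‖hg2.toLp‖ + η := by
      have h3 : ‖f - hg2.toLp‖ ≤ η := by
        have h4 : f - hg2.toLp = hfgm.toLp := by
          rw [MemLp.toLp_sub hf2 hg2, Lp.toLp_coeFn]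
        rw [h4, Lp.norm_toLp]
        exact ENNReal.toReal_le_of_le_ofReal hη.le hfg
      linarith [norm_sub_norm_le f hg2.toLp]
    have h5 := mul_le_mul_of_nonneg_left h2 (Real.sqrt_nonneg (a * δ))
    linarith
  have hlim : √(a * δ) * ‖f‖ ≤ √S := by
    have t : Tendsto (fun η : ℝ => √S + (√c + √(a * δ)) * η) (𝓝[>] 0)
        (𝓝 (√S + (√c + √(a * δ)) * 0)) :=
      ((by fun_prop : Continuous fun η : ℝ => √S + (√c + √(a * δ)) * η).tendsto 0).mono_left
        nhdsWithin_le_nhds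
    rw [mul_zero, add_zero] at t
    exact ge_of_tendsto t (by filter_upwards [self_mem_nhdsWithin] with η hη using happrox η hη)
  have h := pow_le_pow_left₀ (by positivity) hlim 2
  rwa [mul_pow, Real.sq_sqrt (by positivity), Real.sq_sqrt hS0] at h

/-! ### Frame bounds of a tower -/

theorem zero_mem_towerLevel {n : ℕ → ℕ} {J : ℕ → Finset (Fin d → ℤ)} (hJ : ∀ k, 0 ∈ J k) (k : ℕ) :
    0 ∈ towerLevel R n J k := by
  induction k with
  | zero => simp [towerLevel]
  | succ k ih =>
    exact Finset.mem_add.2 ⟨0, ih, 0, Finset.mem_image.2 ⟨0, hJ k, Matrix.mulVec_zero _⟩,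
      add_zero 0⟩

theorem monotone_towerLevel {n : ℕ → ℕ} {J : ℕ → Finset (Fin d → ℤ)} (hJ : ∀ k, 0 ∈ J k) :
    Monotone (towerLevel R n J) :=
  monotone_nat_of_le_succ fun k l hl =>
    Finset.mem_add.2 ⟨l, hl, 0, Finset.mem_image.2 ⟨0, hJ k, Matrix.mulVec_zero _⟩, add_zero l⟩

theorem tendsto_level {n : ℕ → ℕ} (hn : ∀ k, 0 < n k) : Tendsto (level n) atTop atTop :=
  (strictMono_nat_of_lt_succ fun k => by
    rw [level_succ]
    exact Nat.lt_add_of_pos_right (hn k)).tendsto_atTop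

theorem bddBelow_towerDelta (n : ℕ → ℕ) (J : ℕ → Finset (Fin d → ℤ)) :
    BddBelow {r : ℝ | ∃ k, 1 ≤ k ∧ ∃ l ∈ towerLevel R n J k,
      r = ‖fourierMeasure μ (((invMat R).transpose ^ level n k).mulVec (toReal l))‖ ^ 2} := by
  refine ⟨0, ?_⟩
  rintro _ ⟨k, _, l, _, rfl⟩
  positivity

theorem towerDelta_le {n : ℕ → ℕ} {J : ℕ → Finset (Fin d → ℤ)} {k : ℕ} (hk : 1 ≤ k)
    {l : Fin d → ℤ} (hl : l ∈ towerLevel R n J k) :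
    towerDelta R μ n J ≤
      ‖fourierMeasure μ (((invMat R).transpose ^ level n k).mulVec (toReal l))‖ ^ 2 :=
  csInf_le (bddBelow_towerDelta n J) ⟨k, hk, l, hl, rfl⟩

/-- Summability together with nonzero factors makes the limit nonzero. The partial products
decrease, so the limit bounds every finite level from below. -/
theorem exists_hasProd_one_sub {ε : ℕ → ℝ} (h0 : ∀ k, 0 ≤ ε k) (h1 : ∀ k, ε k < 1)
    (hs : Summable ε) : ∃ c, HasProd (fun k => 1 - ε k) c ∧ 0 < c ∧
      ∀ k, c ≤ ∏ i ∈ Finset.range k, (1 - ε i) := by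
  have hs' : Summable fun k => ‖-ε k‖ := by simpa [abs_of_nonneg (h0 _)] using hs
  have hm := multipliable_one_add_of_summable hs'
  have hne := tprod_one_add_ne_zero_of_summable (f := fun k => -ε k)
    (fun k => by have := h1 k; simp only [ne_eq]; intro h; linarith) hs'
  simp only [← sub_eq_add_neg] at hm hne
  have hp : ∀ k, 0 < ∏ i ∈ Finset.range k, (1 - ε i) :=
    fun k => Finset.prod_pos fun i _ => by linarith [h1 i]
  have ht := hm.hasProd.tendsto_prod_nat
  refine ⟨_, hm.hasProd, (ge_of_tendsto' ht fun k => (hp k).le).lt_of_ne' hne, ?_⟩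
  refine (antitone_nat_of_succ_le fun k => ?_).le_of_tendsto ht
  rw [Finset.prod_range_succ]
  exact mul_le_of_le_one_right (hp k).le (by linarith [h0 k])

theorem exists_hasProd_one_add {ε : ℕ → ℝ} (h0 : ∀ k, 0 ≤ ε k) (hs : Summable ε) :
    ∃ C, HasProd (fun k => 1 + ε k) C ∧ ∀ k, ∏ i ∈ Finset.range k, (1 + ε i) ≤ C := by
  have hm := Real.multipliable_one_add_of_summable hs
  have hp : ∀ k, 0 ≤ ∏ i ∈ Finset.range k, (1 + ε i) :=
    fun k => Finset.prod_nonneg fun i _ => by linarith [h0 i]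
  refine ⟨_, hm.hasProd, ?_⟩
  refine (monotone_nat_of_le_succ fun k => ?_).ge_of_tendsto hm.hasProd.tendsto_prod_nat
  rw [Finset.prod_range_succ]
  exact le_mul_of_one_le_right (hp k) (by linarith [h0 k])

theorem IsTower.exists_hasFrameBounds (hμ : IsSelfAffineMeasure R B μ) (hR : IsExpansive R)
    (hB : IsSimpleDigitSet R B) (hBne : B.Nonempty) {ε : ℕ → ℝ} (h0 : ∀ k, 0 ≤ ε k)
    (h1 : ∀ k, ε k < 1) (hs : Summable ε) {n : ℕ → ℕ} {J : ℕ → Finset (Fin d → ℤ)}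
    (hT : IsTower R B ε n J) (hδ : 0 < towerDelta R μ n J) :
    ∃ c C : ℝ, HasProd (fun k => 1 - ε k) c ∧ HasProd (fun k => 1 + ε k) C ∧ 0 < c ∧
      HasFrameBounds μ (tower R n J) (c * towerDelta R μ n J) C := by
  have hd := det_ne_zero_of_isExpansive hR
  obtain ⟨c, hc, hc0, hcle⟩ := exists_hasProd_one_sub h0 h1 hs
  obtain ⟨C, hC, hCle⟩ := exists_hasProd_one_add h0 hs
  have hC1 : 1 ≤ C := by simpa using hCle 0
  have hJ := fun k => isAlmostParseval_iff.1 (hT k).2.2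
  have hΛ := fun k => ((discreteFrame_towerLevel hd hB (fun k => by linarith [h1 k])
    (fun k => by linarith [h0 k]) hJ
    (fun k => (hJ k).incongruentMod (by linarith [h1 k]) hd hB hBne) k).2).mono
      (hcle k) (hCle k)
  -- Levels are shifted by one because the infimum defining `δ(Λ)` starts at `k = 1`.
  refine ⟨c, C, hc, hC, hc0, hμ.hasFrameBounds hR hB hBne hc0.le (by linarith) hδ.le
    (m := fun k => level n (k + 1))
    ((tendsto_level fun k => (hT k).1).comp (tendsto_add_atTop_nat 1))
    (Λ := fun k => towerLevel R n J (k + 1))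
    (fun i j hij => monotone_towerLevel (fun k => (hT k).2.1) (Nat.succ_le_succ hij))
    (fun k => hΛ (k + 1)) (fun k l hl => towerDelta_le (Nat.le_add_left 1 k) hl) fun l => ?_⟩
  constructor
  · rintro ⟨k, hk, hl⟩
    obtain ⟨k, rfl⟩ := Nat.exists_eq_add_of_le' hk
    exact ⟨k, hl⟩
  · rintro ⟨k, hl⟩
    exact ⟨k + 1, Nat.le_add_left 1 k, hl⟩

/-! ### Construction of a tower -/

theorem fourierMeasure_eq (μ : Measure (Fin d → ℝ)) (ξ : Fin d → ℝ) :
    fourierMeasure μ ξ = ∫ x, phase (ξ ⬝ᵥ x) ∂μ := rfl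

theorem continuous_fourierMeasure [IsProbabilityMeasure μ] : Continuous (fourierMeasure μ) := by
  refine continuous_of_dominated (F := fun ξ x => phase (ξ ⬝ᵥ x)) (bound := fun _ => 1) ?_ ?_
    (integrable_const _) ?_
  · intro ξ
    exact (by fun_prop : Continuous fun x : Fin d → ℝ => phase (ξ ⬝ᵥ x)).aestronglyMeasurable
  · exact fun ξ => Eventually.of_forall fun x => (norm_phase _).le
  · exact Eventually.of_forall fun x => by fun_prop

@[simp] theorem fourierMeasure_zero [IsProbabilityMeasure μ] : fourierMeasure μ 0 = 1 := by
  simp [fourierMeasure_eq]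

theorem norm_fourierMeasure_le [IsProbabilityMeasure μ] (ξ : Fin d → ℝ) :
    ‖fourierMeasure μ ξ‖ ≤ 1 := by
  rw [fourierMeasure_eq]
  exact (norm_integral_le_integral_norm _).trans (by simp)

/-- If the periodic zero set is empty, then every point can be translated by an integer vector to
a point near which the Fourier transform is bounded below, uniformly. -/
theorem exists_uniform_lower_bound [IsProbabilityMeasure μ] (hZ : periodicZeroSet μ = ∅) :
    ∃ r > 0, ∃ e > 0, ∀ x : Fin d → ℝ, ∃ k : Fin d → ℤ, ∀ y, ‖y‖ < r →
      e ≤ ‖fourierMeasure μ (x + y + toReal k)‖ ^ 2 := by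
  have hcont := continuous_fourierMeasure (μ := μ)
  -- The index `q` in `(k, q)` discretizes the size of `μ̂`, so a finite subcover of the cube
  -- carries a common positive lower bound, given by the largest `q`.
  set U : (Fin d → ℤ) × ℕ → Set (Fin d → ℝ) :=
    fun p => {y | 1 / ((p.2 : ℝ) + 1) < ‖fourierMeasure μ (y + toReal p.1)‖ ^ 2} with hU
  have hUo : ∀ p, IsOpen (U p) := fun p => isOpen_lt continuous_const (by fun_prop)
  have hK : IsCompact (Set.Icc (0 : Fin d → ℝ) 1) := isCompact_Icc
  have hcov : ∀ y : Fin d → ℝ, ∃ p, y ∈ U p := by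
    intro y
    obtain ⟨k, hk⟩ : ∃ k : Fin d → ℤ, fourierMeasure μ (y + toReal k) ≠ 0 := by
      by_contra! h
      exact Set.notMem_empty y (hZ ▸ (show y ∈ periodicZeroSet μ from h))
    obtain ⟨q, hq⟩ := exists_nat_one_div_lt (show 0 < ‖fourierMeasure μ (y + toReal k)‖ ^ 2 by
      positivity)
    exact ⟨(k, q), hq⟩
  obtain ⟨t, ht⟩ := hK.elim_finite_subcover U hUo fun y _ => Set.mem_iUnion.2 (hcov y)
  obtain ⟨r, hr, hball⟩ := lebesgue_number_lemma_of_metric (c := fun p : t => U p) hK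
    (fun p => hUo p) fun y hy => by
      obtain ⟨p, hp, hyp⟩ := Set.mem_iUnion₂.1 (ht hy)
      exact Set.mem_iUnion.2 ⟨⟨p, hp⟩, hyp⟩
  refine ⟨r, hr, 1 / (((t.sup Prod.snd : ℕ) : ℝ) + 1), by positivity, fun x => ?_⟩
  -- Integer parts reduce `x` to the unit cube and are absorbed in the translation. The Lebesgue
  -- ball is taken in all of `ℝ^d`, so adding `y` may leave the cube.
  set z : Fin d → ℤ := fun i => ⌊x i⌋ with hz
  obtain ⟨p, hp⟩ := hball (x - toReal z) ⟨fun i => by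
    simp [hz, toReal], fun i => by
    simpa [hz, toReal] using (Int.fract_lt_one (x i)).le⟩
  refine ⟨p.1.1 - z, fun y hy => ?_⟩
  have h1 : x - toReal z + y ∈ U p := hp (by simpa [Metric.mem_ball, dist_eq_norm] using hy)
  have h2 : x + y + toReal (p.1.1 - z) = x - toReal z + y + toReal p.1.1 := by
    rw [toReal_sub]
    abel
  rw [h2]
  refine le_trans ?_ (le_of_lt h1)
  have h3 : (p.1.2 : ℝ) ≤ ((t.sup Prod.snd : ℕ) : ℝ) := by
    exact_mod_cast Finset.le_sup (f := Prod.snd) p.2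
  gcongr

/-- One step of the construction: a set of frequencies at a new level that keeps the Fourier
transform away from zero. -/
theorem AlmostParsevalFrameCondition.exists_step (hAP : AlmostParsevalFrameCondition R B)
    (hR : IsExpansive R) (hB : IsSimpleDigitSet R B) (hBne : B.Nonempty) {r e : ℝ} (hr : 0 < r)
    (he : ∀ x : Fin d → ℝ, ∃ k : Fin d → ℤ, ∀ y, ‖y‖ < r →
      e ≤ ‖fourierMeasure μ (x + y + toReal k)‖ ^ 2)
    (he0 : ∀ y, ‖y‖ < r → e ≤ ‖fourierMeasure μ y‖ ^ 2) {ε : ℝ} (hε : 0 < ε) (hε1 : ε < 1)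
    (m : ℕ) (Λ : Finset (Fin d → ℤ)) :
    ∃ (n : ℕ) (J : Finset (Fin d → ℤ)), (0 < n ∧ 0 ∈ J ∧ IsAlmostParseval R B ε n J) ∧
      ∀ l ∈ Λ, ∀ j ∈ J, e ≤ ‖fourierMeasure μ (((invMat R).transpose ^ (m + n)).mulVec
        (toReal (l + (R.transpose ^ m).mulVec j)))‖ ^ 2 := by
  classical
  have hd := det_ne_zero_of_isExpansive hR
  have hev : ∀ᶠ q in atTop, ∀ l ∈ Λ, ‖((invMat R).transpose ^ q).mulVec (toReal l)‖ < r := by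
    refine (Filter.eventually_all_finset Λ).2 fun l _ => ?_
    have h := (tendsto_transpose_invMat_pow_mulVec hR (toReal l)).norm
    rw [norm_zero] at h
    exact h.eventually_lt_const hr
  obtain ⟨n₀, hn₀⟩ := eventually_atTop.1 hev
  obtain ⟨n, hn, J, hJ0, hinj, hJ⟩ := hAP.exists_ge hd hB hBne hε hε1 n₀
  choose k hk using he
  -- The frequency `0` must remain in `J`, so it is not moved; there the lower bound near the
  -- origin, `he0`, is used instead.
  set s : (Fin d → ℤ) → Fin d → ℤ := fun j =>
    if j = 0 then 0 else k (((invMat R).transpose ^ n).mulVec (toReal j)) with hs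
  refine ⟨n, _, ⟨by omega, Finset.mem_image.2 ⟨0, hJ0, ?_⟩,
    isAlmostParseval_iff.2 (hJ.image_add hd hinj s)⟩, ?_⟩
  · simp [hs]
  · intro l hl _ hj
    obtain ⟨j, hj, rfl⟩ := Finset.mem_image.1 hj
    have hsmall := hn₀ (m + n) (by omega) l hl
    have h0 := transpose_invMat_pow_add_mulVec hd n 0 (s j)
    rw [add_zero, pow_zero, Matrix.one_mulVec] at h0
    -- The argument of `μ̂` becomes `(Rᵀ)^{-(m+n)} l + (Rᵀ)^{-n} j + s j`: a small perturbation, a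
    -- base point and its integer translation.
    rw [toReal_add, Matrix.mulVec_add, transpose_invMat_pow_add_mulVec hd, toReal_add,
      Matrix.mulVec_add, h0]
    by_cases hj0 : j = 0
    · simpa [hs, hj0] using he0 _ hsmall
    · simp only [hs, hj0, if_false]
      rw [← add_assoc, add_comm (((invMat R).transpose ^ (m + n)).mulVec (toReal l))]
      exact hk _ _ hsmall

theorem AlmostParsevalFrameCondition.exists_isTower [IsProbabilityMeasure μ]
    (hAP : AlmostParsevalFrameCondition R B) (hR : IsExpansive R) (hB : IsSimpleDigitSet R B)
    (hBne : B.Nonempty) (hZ : periodicZeroSet μ = ∅) {ε : ℕ → ℝ} (h0 : ∀ k, 0 < ε k)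
    (h1 : ∀ k, ε k < 1) :
    ∃ (n : ℕ → ℕ) (J : ℕ → Finset (Fin d → ℤ)), IsTower R B ε n J ∧
      0 < towerDelta R μ n J := by
  obtain ⟨r₁, hr₁, e₁, he₁, hlow⟩ := exists_uniform_lower_bound hZ
  have hc : Continuous fun y => ‖fourierMeasure μ y‖ ^ 2 := continuous_fourierMeasure.norm.pow 2
  -- As `μ̂(0) = 1`, the value `1 / 2` is a lower bound for `|μ̂|²` near the origin.
  obtain ⟨r₂, hr₂, hnear⟩ := Metric.eventually_nhds_iff.1
    ((hc.tendsto 0).eventually_const_lt (u := 1 / 2) (by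
      simp only [fourierMeasure_zero, norm_one]
      norm_num))
  set r := min r₁ r₂
  set e := min e₁ (1 / 2)
  have hr : 0 < r := lt_min hr₁ hr₂
  have he0 : 0 < e := lt_min he₁ (by norm_num)
  choose N F hNF hNF' using fun (k m : ℕ) (Λ : Finset (Fin d → ℤ)) =>
    hAP.exists_step hR hB hBne (μ := μ) (r := r) (e := e) hr
      (fun x => (hlow x).imp fun k hk y hy =>
        (min_le_left _ _).trans (hk y (hy.trans_le (min_le_left _ _))))
      (fun y hy => (min_le_right _ _).trans
        (hnear (by simpa using hy.trans_le (min_le_right _ _))).le) (h0 k) (h1 k) m Λ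
  -- The state is the pair `(m_k, Λ_k)`: each choice of `n` and `J` depends on the whole set of
  -- earlier frequencies.
  let st : ℕ → ℕ × Finset (Fin d → ℤ) := fun k => Nat.rec (0, {0}) (fun k p =>
    (p.1 + N k p.1 p.2,
      (p.2 ×ˢ F k p.1 p.2).image fun q => q.1 + (R.transpose ^ p.1).mulVec q.2)) k
  let n : ℕ → ℕ := fun k => N k (st k).1 (st k).2
  let J : ℕ → Finset (Fin d → ℤ) := fun k => F k (st k).1 (st k).2
  have hst : ∀ k, (st k).1 = level n k ∧ (st k).2 = towerLevel R n J k := by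
    intro k
    induction k with
    | zero => exact ⟨rfl, rfl⟩
    | succ k ih =>
      rw [level_succ, towerLevel, add_image_eq_image_product, ← ih.1, ← ih.2]
      exact ⟨rfl, rfl⟩
  refine ⟨n, J, fun k => hNF k _ _, he0.trans_le (le_csInf ?_ ?_)⟩
  · exact ⟨_, 1, le_rfl, 0, zero_mem_towerLevel (fun k => (hNF k _ _).2.1) 1, rfl⟩
  · rintro _ ⟨k, hk, l, hl, rfl⟩
    obtain ⟨k, rfl⟩ := Nat.exists_eq_add_of_le' hk
    rw [towerLevel, add_image_eq_image_product, Finset.mem_image] at hl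
    obtain ⟨⟨l, j⟩, hp, rfl⟩ := hl
    rw [Finset.mem_product] at hp
    have h := hNF' k (st k).1 (st k).2 l ((hst k).2 ▸ hp.1) j hp.2
    rw [level_succ]
    rw [(hst k).1] at h
    simpa only [n, (hst k).1] using h

theorem towerDelta_le_one [IsProbabilityMeasure μ] {n : ℕ → ℕ} {J : ℕ → Finset (Fin d → ℤ)}
    (hJ : ∀ k, 0 ∈ J k) : towerDelta R μ n J ≤ 1 :=
  (towerDelta_le le_rfl (zero_mem_towerLevel hJ 1)).trans
    (pow_le_one₀ (norm_nonneg _) (norm_fourierMeasure_le _))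

end SelfAffine

theorem mainTheorem5 {d : ℕ} (R : Matrix (Fin d) (Fin d) ℤ) (B : Finset (Fin d → ℤ))
    (hR : SelfAffine.IsExpansive R) (hBne : B.Nonempty)
    (hB : SelfAffine.IsSimpleDigitSet R B)
    (hAP : SelfAffine.AlmostParsevalFrameCondition R B)
    (hZ : SelfAffine.periodicZeroSet (SelfAffine.selfAffineMeasure R B) = ∅) :
    (∃ Λ : Set (Fin d → ℤ), SelfAffine.IsFourierFrame (SelfAffine.selfAffineMeasure R B) Λ) ∧
    (∀ ε : ℕ → ℝ, (∀ k, 0 < ε k) → (∀ k, ε k < 1) → Summable ε →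
      ∃ (n : ℕ → ℕ) (J : ℕ → Finset (Fin d → ℤ)), SelfAffine.IsTower R B ε n J ∧
        0 < SelfAffine.towerDelta R (SelfAffine.selfAffineMeasure R B) n J) ∧
    (∀ ε : ℕ → ℝ, (∀ k, 0 ≤ ε k) → (∀ k, ε k < 1) → Summable ε →
      ∀ (n : ℕ → ℕ) (J : ℕ → Finset (Fin d → ℤ)), SelfAffine.IsTower R B ε n J →
        0 < SelfAffine.towerDelta R (SelfAffine.selfAffineMeasure R B) n J →
        ∃ c C : ℝ, HasProd (fun k => 1 - ε k) c ∧ HasProd (fun k => 1 + ε k) C ∧ 0 < c ∧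
          SelfAffine.HasFrameBounds (SelfAffine.selfAffineMeasure R B)
            (SelfAffine.tower R n J)
            (c * SelfAffine.towerDelta R (SelfAffine.selfAffineMeasure R B) n J) C) := by
  have hμ := SelfAffine.isSelfAffineMeasure_selfAffineMeasure hR hBne
  have := hμ.1
  refine ⟨?_, fun ε h0 h1 _ => hAP.exists_isTower hR hB hBne hZ h0 h1,
    fun ε h0 h1 hs n J hT hδ => hT.exists_hasFrameBounds hμ hR hB hBne h0 h1 hs hδ⟩
  -- For the first claim any summable tolerances do; the exponent `k + 1` keeps the initial one
  -- below `1`.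
  have h0 : ∀ k : ℕ, (0 : ℝ) < (1 / 2) ^ (k + 1) := fun k => by positivity
  have h1 : ∀ k : ℕ, ((1 : ℝ) / 2) ^ (k + 1) < 1 :=
    fun k => pow_lt_one₀ (by norm_num) (by norm_num) k.succ_ne_zero
  have hs : Summable fun k : ℕ => ((1 : ℝ) / 2) ^ (k + 1) :=
    (summable_nat_add_iff 1).2 summable_geometric_two
  obtain ⟨n, J, hT, hδ⟩ := hAP.exists_isTower hR hB hBne hZ h0 h1
  obtain ⟨c, C, hc, hC, hc0, hF⟩ :=
    hT.exists_hasFrameBounds hμ hR hB hBne (fun k => (h0 k).le) h1 hs hδ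
  refine ⟨SelfAffine.tower R n J, _, C, mul_pos hc0 hδ, ?_, hF⟩
  -- The order `A ≤ C` of the frame bounds follows from `δ ≤ 1` and a factorwise comparison of the
  -- two products.
  have hδ1 := SelfAffine.towerDelta_le_one (R := R) (n := n)
    (μ := SelfAffine.selfAffineMeasure R B) fun k => (hT k).2.1
  have hcC : c ≤ C := le_of_tendsto_of_tendsto' hc.tendsto_prod_nat hC.tendsto_prod_nat fun k =>
    Finset.prod_le_prod (fun i _ => by linarith [h1 i]) fun i _ => by linarith [h0 i]
  exact (mul_le_of_le_one_right hc0.le hδ1).trans hcC
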